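/- Consider the consensus problem $\min_{x_1=\dots=x_N}\frac1N\sum_{i=1}^N f_i(x_i)$, $x_i\in\mathbb R^n$, with $f_i=\frac1{m_i}\sum_{h=1}^{m_i}f_{i,h}$, each $f_{i,h}$ differentiable, each $f_i$ convex and $L$-smooth ($\|\nabla f_i(x)-\nabla f_i(y)\|\le L\|x-y\|$), over a connected undirected graph on $\{1,\dots,N\}$ with neighborhoods $\mathcal N_i$, maximum degree at most $d$ and all nonzero Laplacian eigenvalues at least $\lambda>0$. Write $F=\frac1N\sum_i f_i$ and $\bar x=\frac1N\sum_i x_i$. LT-ADMM with penalty $\rho>0$, $\tau\ge1$ local steps and step-size $\gamma>0$ performs, in rounds $k=0,1,\dots$, for every agent $i$: $\phi_{i,k}^0=x_{i,k}$; for $t=0,\dots,\tau-1$, $$\phi_{i,k}^{t+1}=\phi_{i,k}^t-\gamma\Big(g_i(\phi_{i,k}^t)+\rho|\mathcal N_i|\phi_{i,k}^t-\sum_{j\in\mathcal N_i}z_{ij,k}\Big);$$ $x_{i,k+1}=\phi_{i,k}^\tau$; and $z_{ij,k+1}=\frac12\big(z_{ij,k}-(z_{ji,k}-2\rho x_{j,k+1})\big)$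 for $j\in\mathcal N_i$. Here $g_i(\phi)=\frac1{|\mathcal B_i|}\sum_{h\in\mathcal B_i}\nabla f_{i,h}(\phi)$ with a random nonempty batch $\mathcal B_i\subseteq\{1,\dots,m_i\}$, drawn anew at every step $(k,t)$ independently of the other steps, and for every fixed $\phi$, $\mathbb E[g_i(\phi)-\nabla f_i(\phi)]=0$ and $\mathbb E\|g_i(\phi)-\nabla f_i(\phi)\|^2\le\sigma^2$. The initial values are deterministic with $\sum_i\sum_{j\in\mathcal N_i}z_{ij,0}=\rho\sum_i|\mathcal N_i|x_{i,0}$ (for instance $z_{ij,0}=\rho x_{i,0}$). Let $$\mathcal D_k=\mathbb E\Big[\|\nabla F(\bar x_k)\|^2+\frac1\tau\sum_{t=0}^{\tau-1}\Big\|\frac1N\sum_{i=1}^N\nabla f_i(\phi_{i,k}^t)\Big\|^2\Big].$$ Let $u_l$ be an orthonormal eigenbasis of the graph Laplacian, $-\tilde\lambda_l$ the corresponding eigenvalues, and let $\|\widehat{\mathbf d}_0\|^2=\sum_{l:\tilde\lambda_l\neq0}\big\|(V_l^{-1}\otimes I_n)\,[\langle u_l,X\rangle;\langle u_l,Y\rangle;\langle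 u_l,\tilde Y\rangle]\big\|^2$, where $\langle u_l,X\rangle=\sum_i(u_l)_iX_i$, $X_i=x_{i,0}$, $Y_i=\sum_{j\in\mathcal N_i}z_{ij,0}-\nabla f_i(\bar x_0)-\rho|\mathcal N_i|x_{i,0}$, $\tilde Y_i=\sum_{j\in\mathcal N_i}z_{ji,0}+\nabla f_i(\bar x_0)-\rho|\mathcal N_i|x_{i,0}$, and $$V_l=\begin{bmatrix}-\gamma\tau&d_{12}&d_{13}\\1&\tilde\lambda_l\rho d_{12}-1&\tilde\lambda_l\rho d_{13}-1\\1&1&1\end{bmatrix},\qquad d_{12},d_{13}=-\gamma\tau\pm\frac{\sqrt{s(s+2)}}{\tilde\lambda_l\rho},\quad s=\gamma\tau\rho\tilde\lambda_l .$$ Then there is a constant $C>0$ depending only on $L,\rho,d,\lambda$, and for every such graph and every $\tau\ge1$ a step-size bound $\bar\gamma>0$ depending only on these, the graph and $\tau$, such that for all $0<\gamma<\bar\gamma$ the following holds. A point $x^*$ is stationary ($\nabla F(x^*)=0$) if and only if it is an optimal solution of the consensus problem; and for every optimal solution $x^*$ and every $K\ge1$ $$\frac1K\sum_{k=0}^{K-1}\mathcal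 D_k\le C\,\frac{F(\bar x_0)-F(x^*)}{K\gamma\tau}+C\,\gamma\tau\sigma^2+C\,\frac{\|\widehat{\mathbf d}_0\|^2}{\rho KN}.$$ In particular LT-ADMM converges to a neighborhood of an optimum in the sense that, if an optimal solution exists, $\limsup_{K\to\infty}\frac1K\sum_{k<K}\mathcal D_k\le C\gamma\tau\sigma^2$. -/

import Mathlib

namespace LTADMM

/-- The space `ℝⁿ` with its Euclidean norm. -/
abbrev Vec (n : ℕ) : Type := EuclideanSpace ℝ (Fin n)

section Problem

variable {N n : ℕ} {m : Fin N → ℕ}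

/-- The local cost `f_i(x) = (1 / m_i) ∑_h f_{i,h}(x)` of agent `i`. -/
noncomputable def localCost (f : (i : Fin N) → Fin (m i) → Vec n → ℝ) (i : Fin N) (x : Vec n) : ℝ :=
  (1 / (m i : ℝ)) * ∑ h : Fin (m i), f i h x

/-- The average cost `F(x) = (1 / N) ∑_i f_i(x)`. -/
noncomputable def globalCost (f : (i : Fin N) → Fin (m i) → Vec n → ℝ) (x : Vec n) : ℝ :=
  (1 / (N : ℝ)) * ∑ i : Fin N, localCost f i x

/-- `xs` is an optimal solution of the consensus problem: minimize `(1 / N) ∑_i f_i(x_i)` subject to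
`x_1 = ⋯ = x_N`, the optimum being attained at `x_1 = ⋯ = x_N = xs`. -/
def IsConsensusOptimum (f : (i : Fin N) → Fin (m i) → Vec n → ℝ) (xs : Vec n) : Prop :=
  ∀ x : Fin N → Vec n, (∀ i j, x i = x j) →
    (1 / (N : ℝ)) * ∑ i : Fin N, localCost f i xs ≤ (1 / (N : ℝ)) * ∑ i : Fin N, localCost f i (x i)

/-- Each local cost is `L`-smooth (the component losses are differentiable, so that their gradients
are meaningful). -/
def IsSmoothProblem (f : (i : Fin N) → Fin (m i) → Vec n → ℝ) (L : ℝ) : Prop :=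
  (∀ i h, Differentiable ℝ (f i h)) ∧
    ∀ i (x y : Vec n), ‖gradient (localCost f i) x - gradient (localCost f i) y‖ ≤ L * ‖x - y‖

/-- Mini-batch gradient `g_i(φ) = (1 / |b|) ∑_{h ∈ b} ∇f_{i,h}(φ)` of agent `i` on the batch `b`. -/
noncomputable def batchGrad (f : (i : Fin N) → Fin (m i) → Vec n → ℝ) (i : Fin N)
    (b : Finset (Fin (m i))) (φ : Vec n) : Vec n :=
  (1 / (b.card : ℝ)) • ∑ h ∈ b, gradient (f i h) φ

/-- The mean of the agents' vectors. -/
noncomputable def mean (x : Fin N → Vec n) : Vec n :=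
  (1 / (N : ℝ)) • ∑ i : Fin N, x i

/-- Random batches: `B k t ω i` is the batch agent `i` draws in local step `t` of round `k`.
Batches are nonempty, the draws in different steps `(k, t)` are independent, and the resulting
gradient estimators are unbiased with variance at most `σ²`. The law of the draw and
the dependence between agents within one step are otherwise arbitrary; in particular independent
uniform draws of batches of fixed size are allowed. -/
structure IsBatchSampling (f : (i : Fin N) → Fin (m i) → Vec n → ℝ) {Ω : Type*} [MeasurableSpace Ω]
    (P : MeasureTheory.Measure Ω) (B : ℕ → ℕ → Ω → (i : Fin N) → Finset (Fin (m i))) (σ : ℝ) :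
    Prop where
  measurable : ∀ k t, @Measurable Ω _ _ ⊤ (B k t)
  nonempty : ∀ k t ω i, (B k t ω i).Nonempty
  indep : ProbabilityTheory.iIndepFun (m := fun _ : ℕ × ℕ => ⊤)
    (fun kt : ℕ × ℕ => B kt.1 kt.2) P
  unbiased : ∀ k t i (φ : Vec n),
    ∫ ω, (batchGrad f i (B k t ω i) φ - gradient (localCost f i) φ) ∂P = 0
  variance : ∀ k t i (φ : Vec n),
    ∫ ω, ‖batchGrad f i (B k t ω i) φ - gradient (localCost f i) φ‖ ^ 2 ∂P ≤ σ ^ 2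

end Problem

section Algorithm

variable {N n : ℕ} {m : Fin N → ℕ}

/-- Local training of one round: the iterates `φ_i^t` started from `φ_i^0 = x_i`, with auxiliary
variables `z`, where `b t i` is the batch used by agent `i` in local step `t`. -/
noncomputable def localIter (f : (i : Fin N) → Fin (m i) → Vec n → ℝ) (G : SimpleGraph (Fin N))
    [DecidableRel G.Adj] (ρ γ : ℝ) (b : ℕ → (i : Fin N) → Finset (Fin (m i)))
    (x : Fin N → Vec n) (z : Fin N → Fin N → Vec n) : ℕ → Fin N → Vec n
  | 0 => x
  | t + 1 => fun i =>
      localIter f G ρ γ b x z t i - γ • (batchGrad f i (b t i) (localIter f G ρ γ b x z t i)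
        + (ρ * (G.degree i : ℝ)) • localIter f G ρ γ b x z t i - ∑ j ∈ G.neighborFinset i, z i j)

/-- Auxiliary update after a communication: agent `j` sends `z_{ji} - 2ρ x_j` to agent `i`, who sets
`z_{ij} ← (z_{ij} - (z_{ji} - 2ρ x_j)) / 2`. Only the entries with `i`, `j` adjacent matter. -/
noncomputable def auxUpdate (ρ : ℝ) (x : Fin N → Vec n) (z : Fin N → Fin N → Vec n) :
    Fin N → Fin N → Vec n :=
  fun i j => (1 / 2 : ℝ) • (z i j - (z j i - (2 * ρ) • x j))

/-- The state `(x_{·,k}, z_{··,k})` of LT-ADMM after `k` rounds, where `b k t i` is the batch that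
agent `i` uses in local step `t` of round `k`. -/
noncomputable def state (f : (i : Fin N) → Fin (m i) → Vec n → ℝ) (G : SimpleGraph (Fin N))
    [DecidableRel G.Adj] (ρ γ : ℝ) (τ : ℕ) (b : ℕ → ℕ → (i : Fin N) → Finset (Fin (m i)))
    (x₀ : Fin N → Vec n) (z₀ : Fin N → Fin N → Vec n) :
    ℕ → (Fin N → Vec n) × (Fin N → Fin N → Vec n)
  | 0 => (x₀, z₀)
  | k + 1 =>
      let s := state f G ρ γ τ b x₀ z₀ k
      let x' := localIter f G ρ γ (b k) s.1 s.2 τ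
      (x', auxUpdate ρ x' s.2)

/-- The local iterate `φ_{i,k}^t` of LT-ADMM. -/
noncomputable def phi (f : (i : Fin N) → Fin (m i) → Vec n → ℝ) (G : SimpleGraph (Fin N))
    [DecidableRel G.Adj] (ρ γ : ℝ) (τ : ℕ) (b : ℕ → ℕ → (i : Fin N) → Finset (Fin (m i)))
    (x₀ : Fin N → Vec n) (z₀ : Fin N → Fin N → Vec n) (k t : ℕ) : Fin N → Vec n :=
  localIter f G ρ γ (b k) (state f G ρ γ τ b x₀ z₀ k).1 (state f G ρ γ τ b x₀ z₀ k).2 t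

/-- The convergence metric
`𝒟_k = 𝔼[‖∇F(x̄_k)‖² + (1/τ) ∑_{t<τ} ‖(1/N) ∑_i ∇f_i(φ_{i,k}^t)‖²]`. -/
noncomputable def metric (f : (i : Fin N) → Fin (m i) → Vec n → ℝ) (G : SimpleGraph (Fin N))
    [DecidableRel G.Adj] (ρ γ : ℝ) (τ : ℕ) {Ω : Type*} [MeasurableSpace Ω]
    (P : MeasureTheory.Measure Ω) (B : ℕ → ℕ → Ω → (i : Fin N) → Finset (Fin (m i)))
    (x₀ : Fin N → Vec n) (z₀ : Fin N → Fin N → Vec n) (k : ℕ) : ℝ :=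
  ∫ ω, (‖gradient (globalCost f)
          (mean (state f G ρ γ τ (fun k t => B k t ω) x₀ z₀ k).1)‖ ^ 2
      + (1 / (τ : ℝ)) * ∑ t ∈ Finset.range τ,
          ‖mean (fun i => gradient (localCost f i)
            (phi f G ρ γ τ (fun k t => B k t ω) x₀ z₀ k t i))‖ ^ 2) ∂P

end Algorithm

section InitialDeviation

variable {N n : ℕ} {m : Fin N → ℕ}

/-- The graph Laplacian is Hermitian. -/
theorem lap_isHermitian (G : SimpleGraph (Fin N)) [DecidableRel G.Adj] :
    (G.lapMatrix ℝ).IsHermitian :=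
  (SimpleGraph.posSemidef_lapMatrix ℝ G).isHermitian

/-- The eigenvalues of the graph Laplacian, with multiplicity. -/
noncomputable def lapEig (G : SimpleGraph (Fin N)) [DecidableRel G.Adj] : Fin N → ℝ :=
  (lap_isHermitian G).eigenvalues

/-- The component `∑_j (u_l)_j X_j ∈ ℝⁿ` of `X = (X_1, …, X_N)` along the `l`-th vector `u_l` of an
orthonormal eigenbasis of the graph Laplacian. -/
noncomputable def modeComponent (G : SimpleGraph (Fin N)) [DecidableRel G.Adj] (l : Fin N)
    (X : Fin N → Vec n) : Vec n :=
  ∑ j : Fin N, ((lap_isHermitian G).eigenvectorBasis l j) • X j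

/-- `Y_i = ∑_{j ∈ N_i} z_{ij} - ∇f_i(x̄) - ρ |N_i| x_i`. -/
noncomputable def devY (f : (i : Fin N) → Fin (m i) → Vec n → ℝ) (G : SimpleGraph (Fin N))
    [DecidableRel G.Adj] (ρ : ℝ) (x : Fin N → Vec n) (z : Fin N → Fin N → Vec n) : Fin N → Vec n :=
  fun i => ∑ j ∈ G.neighborFinset i, z i j - gradient (localCost f i) (mean x)
    - (ρ * (G.degree i : ℝ)) • x i

/-- `Ỹ_i = ∑_{j ∈ N_i} z_{ji} + ∇f_i(x̄) - ρ |N_i| x_i`. -/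
noncomputable def devYt (f : (i : Fin N) → Fin (m i) → Vec n → ℝ) (G : SimpleGraph (Fin N))
    [DecidableRel G.Adj] (ρ : ℝ) (x : Fin N → Vec n) (z : Fin N → Fin N → Vec n) : Fin N → Vec n :=
  fun i => ∑ j ∈ G.neighborFinset i, z j i + gradient (localCost f i) (mean x)
    - (ρ * (G.degree i : ℝ)) • x i

/-- For an eigenvalue `lam < 0` of minus the Laplacian and `0 < γ τ < 2 / (ρ |lam|)`, the matrix `V`
whose columns are eigenvectors of
`[[1, γτ, 0], [ρ lam, ρ lam γτ + 1/2, -1/2], [0, -1/2, 1/2]]`. With `s = γ τ ρ lam ∈ (-2, 0)`, the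
number `r` below is the square root of the negative number `s (s + 2)`. -/
noncomputable def modeMatrix (ρ γ : ℝ) (τ : ℕ) (lam : ℝ) : Matrix (Fin 3) (Fin 3) ℂ :=
  let s : ℝ := γ * τ * ρ * lam
  let r : ℂ := Complex.I * (Real.sqrt (-(s * (s + 2))) : ℂ)
  let d₁₂ : ℂ := -(γ * τ : ℂ) + r / (lam * ρ : ℂ)
  let d₁₃ : ℂ := -(γ * τ : ℂ) - r / (lam * ρ : ℂ)
  !![-(γ * τ : ℂ), d₁₂, d₁₃;
     1, lam * ρ * d₁₂ - 1, lam * ρ * d₁₃ - 1;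
     1, 1, 1]

/-- `‖d̂‖²` for the state `(x, z)`: the squared norm of the vector `V̂⁻¹ [Q̂ᵀX; Q̂ᵀY; Q̂ᵀỸ]`, computed in an
orthonormal eigenbasis of the Laplacian. The columns of `Q̂` span the orthogonal complement of the
constants, which for a connected graph is the sum of the eigenspaces of the nonzero eigenvalues;
the matrix `V̂⁻¹` acts on each eigenvector, and on each of the `n` coordinates, through the inverse
of the corresponding `3 × 3` matrix. The value does not depend on the chosen eigenbasis. -/
noncomputable def dhatSq (f : (i : Fin N) → Fin (m i) → Vec n → ℝ) (G : SimpleGraph (Fin N))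
    [DecidableRel G.Adj] (ρ γ : ℝ) (τ : ℕ) (x : Fin N → Vec n) (z : Fin N → Fin N → Vec n) : ℝ :=
  ∑ l : Fin N, if lapEig G l = 0 then 0 else
    ∑ c : Fin n, ∑ a : Fin 3,
      ‖((modeMatrix ρ γ τ (-lapEig G l))⁻¹.mulVec
        ![(modeComponent G l x c : ℂ),
          (modeComponent G l (devY f G ρ x z) c : ℂ),
          (modeComponent G l (devYt f G ρ x z) c : ℂ)]) a‖ ^ 2

end InitialDeviation

end LTADMM

/-! Put h = γτ and let ℒ be the Laplacian. After a communication the symmetric part of the auxiliary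
variables is a function of the new x alone. The antisymmetric part, summed over neighbours, is a
dual variable ω with ω' = ω - (ρ/2)ℒx'. So from the second round on, a round is, up to local drift
and noise, the semi-implicit primal-dual step x' ≈ x + h(ω - (ρ/2)ℒx - ∇f(x)), where ∇f(x) stacks
the local gradients.

On a Laplacian mode with eigenvalue μ > 0 let c = ρμ, let X be the component of x, W that of ω -
∇f(x̄), and D the displacement of X in the round. In the energy ½‖X‖² + (h/c)‖W‖² the cross terms
between X and W cancel (`mode_energy_identity`), which leaves damping in X and in D. The damping of
X, of size hc, may be too weak for the term h⟨X, ∇f(x) - ∇f(x̄)⟩, of size hL; but summed over the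
modes this term has a sign, by convexity (`IsRound.energy_le`). Nothing damps W. Wherever W enters
an error, above all in the local drift, it is recovered from D (`IsRound.driftSq_le`).

The balance condition removes the dual variable from the mean, so x̄ performs inexact gradient
descent on F (`IsRound.cost_le`). For a large enough weight A the function N·F(x̄) + A·energy
decreases by (h/8)N times the integrand of the metric, up to a term linear in the noise and one
quadratic in it (`IsRound.lyapunov_le`). The linear term has coefficients fixed at the start of the
round, hence mean zero (`integral_inner_roundNoise`); the quadratic one has mean at most a constant
times h²Nσ². Telescoping and dividing by hNK give the bound.

For the last term of the bound, the initial energy must be of order h‖d̂₀‖². This holds because the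
entries in the first row of V_l have squared modulus at most 2h/c, and W carries the weight h/c
(`energy_add_residual_le`). Initial auxiliary variables whose symmetric part is not yet tied to x
cost an extra error in the first round only. -/

namespace LTADMM

/-! ### Norm inequalities and the energy of one Laplacian mode -/

section VectorInequalities

variable {E : Type*} [NormedAddCommGroup E]

theorem norm_sum_sq_le_card_mul {ι : Type*} (s : Finset ι) (v : ι → E) :
    ‖∑ i ∈ s, v i‖ ^ 2 ≤ s.card * ∑ i ∈ s, ‖v i‖ ^ 2 := by
  calc ‖∑ i ∈ s, v i‖ ^ 2 ≤ (∑ i ∈ s, ‖v i‖) ^ 2 := by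
        gcongr; exact norm_sum_le _ _
    _ ≤ s.card * ∑ i ∈ s, ‖v i‖ ^ 2 := sq_sum_le_card_mul_sum_sq

theorem norm_add_sq_le_two (a b : E) : ‖a + b‖ ^ 2 ≤ 2 * (‖a‖ ^ 2 + ‖b‖ ^ 2) := by
  have h := norm_add_le a b
  nlinarith [norm_nonneg (a + b), norm_nonneg a, norm_nonneg b, sq_nonneg (‖a‖ - ‖b‖)]

theorem norm_sub_sq_le_two (a b : E) : ‖a - b‖ ^ 2 ≤ 2 * (‖a‖ ^ 2 + ‖b‖ ^ 2) := by
  simpa [sub_eq_add_neg] using norm_add_sq_le_two a (-b)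

theorem norm_add_sq_le_three (a b c : E) :
    ‖a + b + c‖ ^ 2 ≤ 3 * (‖a‖ ^ 2 + ‖b‖ ^ 2 + ‖c‖ ^ 2) := by
  have h := norm_sum_sq_le_card_mul Finset.univ ![a, b, c]
  simpa [Fin.sum_univ_three] using h

theorem norm_add_sq_le_four (a b c d : E) :
    ‖a + b + c + d‖ ^ 2 ≤ 4 * (‖a‖ ^ 2 + ‖b‖ ^ 2 + ‖c‖ ^ 2 + ‖d‖ ^ 2) := by
  have h := norm_sum_sq_le_card_mul Finset.univ ![a, b, c, d]
  simpa [Fin.sum_univ_four] using h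

variable [InnerProductSpace ℝ E]

/-- Young's inequality for the inner product. -/
theorem inner_le_young (a b : E) {t s : ℝ} (ht : 0 < t) (hts : 4 * t * s = 1) :
    inner ℝ a b ≤ t * ‖a‖ ^ 2 + s * ‖b‖ ^ 2 := by
  have h1 := real_inner_le_norm a b
  have h2 : 0 ≤ t * (2 * t * ‖a‖ - ‖b‖) ^ 2 := by positivity
  have h3 : t * (2 * t * ‖a‖ - ‖b‖) ^ 2
      = 4 * t ^ 2 * (t * ‖a‖ ^ 2 + s * ‖b‖ ^ 2 - ‖a‖ * ‖b‖) := by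
    linear_combination (-t * ‖b‖ ^ 2) * hts
  rw [h3] at h2
  have h4 := nonneg_of_mul_nonneg_right h2 (by positivity)
  linarith

theorem neg_inner_le_young (a b : E) {t s : ℝ} (ht : 0 < t) (hts : 4 * t * s = 1) :
    -inner ℝ a b ≤ t * ‖a‖ ^ 2 + s * ‖b‖ ^ 2 := by
  simpa using inner_le_young a (-b) ht hts

/-- The weight `h / c` is chosen so that `h * inner ℝ (X + D) W`, produced by the first square, is
cancelled by the cross term of the second. Pairing with the new point `X + D` is natural because the
dual step is taken there. What survives is damping in `X` and `D` and the products with the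
perturbations `G`, `q`, `ν`. -/
theorem mode_energy_identity {h c : ℝ} (hh : 0 < h) (hc : 0 < c) {X W G q ν D : E}
    (hD : D = h • (W - (c / 2) • X - G + q) - ν) :
    1 / 2 * ‖X + D‖ ^ 2 + h / c * ‖W - (c / 2) • (X + D)‖ ^ 2
      = 1 / 2 * ‖X‖ ^ 2 + h / c * ‖W‖ ^ 2 - h * c / 4 * ‖X‖ ^ 2 + (h * c / 4 - 1 / 2) * ‖D‖ ^ 2
        - inner ℝ (X + D) ν - h * inner ℝ (X + D) G + h * inner ℝ (X + D) q := by
  have hW : inner ℝ (X + D) D = h * inner ℝ (X + D) W - h * c / 2 * inner ℝ (X + D) X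
      - h * inner ℝ (X + D) G + h * inner ℝ (X + D) q - inner ℝ (X + D) ν := by
    conv_lhs => rw [show inner ℝ (X + D) D
      = inner ℝ (X + D) (h • (W - (c / 2) • X - G + q) - ν) from congrArg _ hD]
    simp only [inner_sub_right, inner_add_right (X + D), inner_smul_right]
    ring
  have e1 : ‖W - (c / 2) • (X + D)‖ ^ 2
      = ‖W‖ ^ 2 - c * inner ℝ (X + D) W + c ^ 2 / 4 * ‖X + D‖ ^ 2 := by
    rw [norm_sub_sq_real, inner_smul_right, norm_smul, mul_pow, Real.norm_eq_abs, sq_abs,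
      real_inner_comm]
    ring
  have e2 : ‖X + D‖ ^ 2 = ‖X‖ ^ 2 + 2 * inner ℝ X D + ‖D‖ ^ 2 := norm_add_sq_real _ _
  have e3 : inner ℝ (X + D) D = inner ℝ X D + ‖D‖ ^ 2 := by
    rw [inner_add_left, real_inner_self_eq_norm_sq]
  have e4 : inner ℝ (X + D) X = ‖X‖ ^ 2 + inner ℝ X D := by
    rw [inner_add_left, real_inner_self_eq_norm_sq, real_inner_comm]
  rw [e1]
  have e5 : h / c * (‖W‖ ^ 2 - c * inner ℝ (X + D) W + c ^ 2 / 4 * ‖X + D‖ ^ 2)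
      = h / c * ‖W‖ ^ 2 - h * inner ℝ (X + D) W + h * c / 4 * ‖X + D‖ ^ 2 := by
    field_simp
  rw [e5, e2]
  rw [e3, e4] at hW
  linarith

/-- Decrease of the energy of one Laplacian mode in one round. -/
theorem mode_energy_step {h c : ℝ} (hh : 0 < h) (hc : 0 < c) (hhc : h * c ≤ 1 / 2)
    {X W G q ν η D : E} (hD : D = h • (W - (c / 2) • X - G + q) - ν) :
    1 / 2 * ‖X + D‖ ^ 2 + h / c * ‖W - (c / 2) • (X + D) - η‖ ^ 2
      ≤ 1 / 2 * ‖X‖ ^ 2 + h / c * ‖W‖ ^ 2 - 3 * (h * c) / 16 * ‖X‖ ^ 2 - 1 / 8 * ‖D‖ ^ 2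
        - inner ℝ X ν - h * inner ℝ X G
        + 5 * h ^ 2 * ‖G‖ ^ 2 + 8 * h / c * ‖q‖ ^ 2 + 5 * ‖ν‖ ^ 2 + 65 / c ^ 2 * ‖η‖ ^ 2 := by
  have hid := mode_energy_identity hh hc hD
  set W2 := W - (c / 2) • (X + D) with hW2
  -- The energy has no damping in `W2`, but the update equation expresses `h • W2` through the
  -- displacement. This absorbs the shift `η` below.
  have hT : h • W2 = (1 - h * c / 2) • D + ν + h • G + (-(h • q)) := by
    have : h • W = D + ν + h • ((c / 2) • X) + h • G - h • q := by
      rw [hD]; simp only [smul_sub, smul_add]; abel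
    rw [hW2, smul_sub, this, sub_smul, one_smul]
    simp only [smul_smul, smul_add, show h * (c / 2) = h * c / 2 by ring]
    abel
  have hW2n : h ^ 2 * ‖W2‖ ^ 2 ≤ 4 * (‖D‖ ^ 2 + ‖ν‖ ^ 2 + h ^ 2 * ‖G‖ ^ 2 + h ^ 2 * ‖q‖ ^ 2) := by
    have e : h ^ 2 * ‖W2‖ ^ 2 = ‖h • W2‖ ^ 2 := by
      rw [norm_smul, mul_pow, Real.norm_eq_abs, sq_abs]
    rw [e, hT]
    refine (norm_add_sq_le_four _ _ _ _).trans ?_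
    simp only [norm_smul, norm_neg, mul_pow, Real.norm_eq_abs, sq_abs]
    have : (1 - h * c / 2) ^ 2 ≤ 1 := by
      have : 0 < h * c := by positivity
      nlinarith
    have := mul_le_mul_of_nonneg_right this (sq_nonneg ‖D‖)
    linarith
  -- The available ½‖D‖² is spent as follows: 1/16 in each of `y1`, `y2`, `y3`, another 1/16 in `y5`
  -- by way of `hW2n`, and 1/8 in `y8`; 1/8 remains.
  have y1 : -(h * inner ℝ D G) ≤ 1 / 16 * ‖D‖ ^ 2 + 4 * (h ^ 2 * ‖G‖ ^ 2) := by
    have := neg_inner_le_young D (h • G) (t := 1 / 16) (s := 4) (by norm_num) (by norm_num)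
    rw [inner_smul_right, norm_smul, mul_pow, Real.norm_eq_abs, sq_abs] at this
    linarith
  have y2 : h * inner ℝ D q ≤ 1 / 16 * ‖D‖ ^ 2 + 4 * (h ^ 2 * ‖q‖ ^ 2) := by
    have := inner_le_young D (h • q) (t := 1 / 16) (s := 4) (by norm_num) (by norm_num)
    rw [inner_smul_right, norm_smul, mul_pow, Real.norm_eq_abs, sq_abs] at this
    linarith
  have y3 : -inner ℝ D ν ≤ 1 / 16 * ‖D‖ ^ 2 + 4 * ‖ν‖ ^ 2 := by
    have := neg_inner_le_young D ν (t := 1 / 16) (s := 4) (by norm_num) (by norm_num)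
    linarith
  have y4 : h * inner ℝ X q ≤ h * c / 16 * ‖X‖ ^ 2 + 4 * h / c * ‖q‖ ^ 2 := by
    have := mul_le_mul_of_nonneg_left (inner_le_young X q (t := c / 16) (s := 4 / c)
      (by positivity) (by field_simp; norm_num)) hh.le
    refine this.trans_eq ?_
    field_simp
  -- The Young weight `h * c / 128` leaves only `h ^ 2 * ‖W2‖ ^ 2`, which `hW2n` controls. The price
  -- 65/c² carries no factor h; this is harmless because `η` will be bounded by a displacement of
  -- the mean, itself of order h.
  have y5 : h / c * ‖W2 - η‖ ^ 2
      ≤ h / c * ‖W2‖ ^ 2 + 1 / 64 * (h ^ 2 * ‖W2‖ ^ 2) + 65 / c ^ 2 * ‖η‖ ^ 2 := by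
    have k1 : ‖W2 - η‖ ^ 2 = ‖W2‖ ^ 2 - 2 * inner ℝ W2 η + ‖η‖ ^ 2 := norm_sub_sq_real _ _
    have k2 := neg_inner_le_young W2 η (t := h * c / 128) (s := 32 / (h * c)) (by positivity)
      (by field_simp; norm_num)
    have k3 : ‖W2 - η‖ ^ 2 ≤ ‖W2‖ ^ 2 + 2 * (h * c / 128 * ‖W2‖ ^ 2
        + 32 / (h * c) * ‖η‖ ^ 2) + ‖η‖ ^ 2 := by linarith
    have k4 := mul_le_mul_of_nonneg_left k3 (show 0 ≤ h / c by positivity)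
    refine k4.trans ?_
    have k5 : h / c ≤ 1 / c ^ 2 := by
      rw [div_le_div_iff₀ hc (by positivity)]; nlinarith
    have k6 := mul_le_mul_of_nonneg_right k5 (sq_nonneg ‖η‖)
    have k7 : h / c * (‖W2‖ ^ 2 + 2 * (h * c / 128 * ‖W2‖ ^ 2
        + 32 / (h * c) * ‖η‖ ^ 2) + ‖η‖ ^ 2)
        = h / c * ‖W2‖ ^ 2 + 1 / 64 * (h ^ 2 * ‖W2‖ ^ 2) + 64 / c ^ 2 * ‖η‖ ^ 2
          + h / c * ‖η‖ ^ 2 := by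
      field_simp; ring
    have k8 : 65 / c ^ 2 * ‖η‖ ^ 2 = 64 / c ^ 2 * ‖η‖ ^ 2 + 1 / c ^ 2 * ‖η‖ ^ 2 := by ring
    linarith
  have y6 : h ^ 2 ≤ 1 / 2 * (h / c) := by
    have : h ^ 2 * c ≤ 1 / 2 * h := by nlinarith
    rw [← mul_div_assoc, le_div_iff₀ hc]; exact this
  have y7 := mul_le_mul_of_nonneg_right y6 (sq_nonneg ‖q‖)
  have y8 : (h * c / 4) * ‖D‖ ^ 2 ≤ 1 / 8 * ‖D‖ ^ 2 := by
    have := mul_le_mul_of_nonneg_right hhc (sq_nonneg ‖D‖); linarith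
  have y9 : 8 * h / c * ‖q‖ ^ 2 = 8 * (h / c * ‖q‖ ^ 2) := by ring
  have y10 : 4 * h / c * ‖q‖ ^ 2 = 4 * (h / c * ‖q‖ ^ 2) := by ring
  have y11 : 0 ≤ h / c * ‖q‖ ^ 2 := by positivity
  have y12 : 0 ≤ h ^ 2 * ‖G‖ ^ 2 := by positivity
  have y13 := sq_nonneg ‖ν‖
  simp only [inner_add_left, mul_add] at hid
  linarith

end VectorInequalities

/-! ### Laplacian modes and the splitting into mean and deviation -/

section Spectral

variable {N n : ℕ}

/-- The graph Laplacian acting on families of vectors. -/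
noncomputable def lapOp (G : SimpleGraph (Fin N)) [DecidableRel G.Adj] (X : Fin N → Vec n) :
    Fin N → Vec n :=
  fun i => (G.degree i : ℝ) • X i - ∑ j ∈ G.neighborFinset i, X j

variable (G : SimpleGraph (Fin N)) [DecidableRel G.Adj]

theorem modeComponent_add (l : Fin N) (X Y : Fin N → Vec n) :
    modeComponent G l (X + Y) = modeComponent G l X + modeComponent G l Y := by
  simp [modeComponent, smul_add, Finset.sum_add_distrib]

theorem modeComponent_smul (l : Fin N) (c : ℝ) (X : Fin N → Vec n) :
    modeComponent G l (c • X) = c • modeComponent G l X := by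
  simp only [modeComponent, Pi.smul_apply, Finset.smul_sum]
  exact Finset.sum_congr rfl fun j _ => smul_comm _ _ _

theorem modeComponent_sub (l : Fin N) (X Y : Fin N → Vec n) :
    modeComponent G l (X - Y) = modeComponent G l X - modeComponent G l Y := by
  simp [modeComponent, smul_sub, Finset.sum_sub_distrib]

/-- This is completeness of the eigenbasis, U U* = 1, rather than its orthonormality U* U = 1. -/
theorem sum_eigenvectorBasis_mul (j k : Fin N) :
    ∑ l, (lap_isHermitian G).eigenvectorBasis l j * (lap_isHermitian G).eigenvectorBasis l k
      = if j = k then 1 else 0 := by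
  have h := Unitary.coe_mul_star_self (lap_isHermitian G).eigenvectorUnitary
  have h2 := congrFun (congrFun h j) k
  simpa [Matrix.mul_apply, Matrix.one_apply, Matrix.star_apply] using h2

/-- Parseval's identity for the Laplacian eigenbasis. -/
theorem sum_inner_modeComponent (X Y : Fin N → Vec n) :
    ∑ l, inner ℝ (modeComponent G l X) (modeComponent G l Y) = ∑ i, inner ℝ (X i) (Y i) := by
  simp only [modeComponent, sum_inner, inner_sum, inner_smul_left, inner_smul_right,
    Finset.mul_sum]
  rw [Finset.sum_comm]
  refine Finset.sum_congr rfl fun j _ => ?_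
  rw [Finset.sum_comm]
  have : ∀ k, ∑ l, (lap_isHermitian G).eigenvectorBasis l j
      * ((starRingEnd ℝ) ((lap_isHermitian G).eigenvectorBasis l k) * inner ℝ (X k) (Y j))
      = if j = k then inner ℝ (X k) (Y j) else 0 := by
    intro k
    have h := sum_eigenvectorBasis_mul G j k
    calc _ = (∑ l, (lap_isHermitian G).eigenvectorBasis l j
          * (lap_isHermitian G).eigenvectorBasis l k) * inner ℝ (X k) (Y j) := by
          rw [Finset.sum_mul]
          exact Finset.sum_congr rfl fun l _ => by simp [mul_assoc]
      _ = _ := by rw [h]; split_ifs <;> simp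
  rw [Finset.sum_congr rfl fun k _ => this k]
  simp

theorem lap_eigenvectorBasis (l i : Fin N) :
    (G.degree i : ℝ) * (lap_isHermitian G).eigenvectorBasis l i
      - ∑ j ∈ G.neighborFinset i, (lap_isHermitian G).eigenvectorBasis l j
      = lapEig G l * (lap_isHermitian G).eigenvectorBasis l i := by
  have h := congrFun ((lap_isHermitian G).mulVec_eigenvectorBasis l) i
  rw [SimpleGraph.lapMatrix_mulVec_apply] at h
  simpa [lapEig] using h

theorem sum_neighborFinset_comm {M : Type*} [AddCommMonoid M] (a : Fin N → Fin N → M) :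
    ∑ i, ∑ j ∈ G.neighborFinset i, a i j = ∑ j, ∑ i ∈ G.neighborFinset j, a i j := by
  refine Finset.sum_comm' fun i j => ?_
  simp [SimpleGraph.adj_comm]

theorem modeComponent_lapOp (l : Fin N) (X : Fin N → Vec n) :
    modeComponent G l (lapOp G X) = lapEig G l • modeComponent G l X := by
  have h : ∑ i, ∑ j ∈ G.neighborFinset i, (lap_isHermitian G).eigenvectorBasis l i • X j
      = ∑ i, ∑ j ∈ G.neighborFinset i, (lap_isHermitian G).eigenvectorBasis l j • X i :=
    sum_neighborFinset_comm G _
  simp only [modeComponent, lapOp, smul_sub, Finset.sum_sub_distrib, Finset.smul_sum, h]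
  rw [← Finset.sum_sub_distrib]
  refine Finset.sum_congr rfl fun i _ => ?_
  rw [smul_smul, smul_smul, ← lap_eigenvectorBasis, sub_smul, Finset.sum_smul, mul_comm]

theorem lapOp_const (v : Vec n) : lapOp G (fun _ => v) = 0 := by
  funext i
  simp [lapOp, Nat.cast_smul_eq_nsmul]

theorem modeComponent_const {l : Fin N} (hl : lapEig G l ≠ 0) (v : Vec n) :
    modeComponent G l (fun _ => v) = 0 := by
  have h := modeComponent_lapOp G l (fun _ => v)
  rw [lapOp_const] at h
  have h0 : modeComponent G l (0 : Fin N → Vec n) = 0 := by simp [modeComponent]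
  rw [h0] at h
  exact (smul_eq_zero.mp h.symm).resolve_left hl

theorem lapEig_nonneg (l : Fin N) : 0 ≤ lapEig G l :=
  (SimpleGraph.posSemidef_lapMatrix ℝ G).eigenvalues_nonneg l

/-- Connectedness enters here: the kernel of the Laplacian consists of constants, so such a
component is a multiple of the sum. -/
theorem modeComponent_eq_zero_of_sum_eq_zero (hG : G.Connected) {l : Fin N} (hl : lapEig G l = 0)
    {X : Fin N → Vec n} (hX : ∑ i, X i = 0) : modeComponent G l X = 0 := by
  have h := (lap_isHermitian G).mulVec_eigenvectorBasis l
  have hl' : (lap_isHermitian G).eigenvalues l = 0 := hl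
  rw [hl', zero_smul, SimpleGraph.lapMatrix_mulVec_eq_zero_iff_forall_reachable] at h
  obtain ⟨i₀⟩ := hG.nonempty
  have : ∀ j, (lap_isHermitian G).eigenvectorBasis l j
      = (lap_isHermitian G).eigenvectorBasis l i₀ := fun j => h j i₀ (hG.preconnected j i₀)
  simp only [modeComponent, this, ← Finset.smul_sum, hX, smul_zero]

/-- The indices of the nonconstant Laplacian modes. -/
noncomputable def modes : Finset (Fin N) := Finset.univ.filter fun l => lapEig G l ≠ 0

theorem mem_modes {l : Fin N} : l ∈ modes G ↔ lapEig G l ≠ 0 := by simp [modes]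

/-- The total square norm over the nonconstant modes. -/
noncomputable def perpSq (X : Fin N → Vec n) : ℝ := ∑ l ∈ modes G, ‖modeComponent G l X‖ ^ 2

theorem perpSq_nonneg (X : Fin N → Vec n) : 0 ≤ perpSq G X :=
  Finset.sum_nonneg fun _ _ => by positivity

theorem perpSq_le (X : Fin N → Vec n) : perpSq G X ≤ ∑ i, ‖X i‖ ^ 2 := by
  have h := sum_inner_modeComponent G X X
  simp only [real_inner_self_eq_norm_sq] at h
  rw [← h]
  exact Finset.sum_le_sum_of_subset_of_nonneg (Finset.subset_univ _) fun _ _ _ => by positivity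

theorem sum_sub_mean (hN : 0 < N) (X : Fin N → Vec n) : ∑ i, (X i - mean X) = 0 := by
  have : (N : ℝ) ≠ 0 := by positivity
  simp [mean, Finset.sum_sub_distrib, ← Nat.cast_smul_eq_nsmul ℝ, smul_smul, this]

theorem modeComponent_sub_mean {l : Fin N} (hl : lapEig G l ≠ 0) (X : Fin N → Vec n) (v : Vec n) :
    modeComponent G l (fun i => X i - v) = modeComponent G l X := by
  have := modeComponent_sub G l X (fun _ => v)
  rw [modeComponent_const G hl, sub_zero] at this
  exact this

/-- Translates mode-wise products back into agent-wise ones, where monotonicity of the gradients can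
be applied. Components do not inherit monotonicity individually. -/
theorem sum_modes_inner (hG : G.Connected) (X Y : Fin N → Vec n) :
    ∑ l ∈ modes G, inner ℝ (modeComponent G l X) (modeComponent G l Y)
      = ∑ i, inner ℝ (X i - mean X) (Y i) := by
  have hN : 0 < N := Fin.pos_iff_nonempty.mpr hG.nonempty
  have h := sum_inner_modeComponent G (fun i => X i - mean X) Y
  rw [← h]
  symm
  rw [← Finset.sum_subset (Finset.subset_univ (modes G))]
  · refine Finset.sum_congr rfl fun l hl => ?_
    rw [modeComponent_sub_mean G ((mem_modes G).mp hl)]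
  · intro l _ hl
    rw [mem_modes, not_not] at hl
    rw [modeComponent_eq_zero_of_sum_eq_zero G hG hl (sum_sub_mean hN X), inner_zero_left]

theorem perpSq_eq (hG : G.Connected) (X : Fin N → Vec n) :
    perpSq G X = ∑ i, ‖X i - mean X‖ ^ 2 := by
  have hN : 0 < N := Fin.pos_iff_nonempty.mpr hG.nonempty
  have h := sum_modes_inner G hG X X
  simp only [real_inner_self_eq_norm_sq] at h
  rw [perpSq, h]
  have : ∑ i, inner ℝ (X i - mean X) (X i)
      = ∑ i, inner ℝ (X i - mean X) (X i - mean X) + inner ℝ (∑ i, (X i - mean X)) (mean X) := by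
    rw [sum_inner, ← Finset.sum_add_distrib]
    exact Finset.sum_congr rfl fun i _ => by rw [← inner_add_right]; simp
  rw [this, sum_sub_mean hN]
  simp

/-- Orthogonal decomposition into deviation and mean. -/
theorem sum_norm_sq_eq (hG : G.Connected) (X : Fin N → Vec n) :
    ∑ i, ‖X i‖ ^ 2 = perpSq G X + N * ‖mean X‖ ^ 2 := by
  have hN : 0 < N := Fin.pos_iff_nonempty.mpr hG.nonempty
  rw [perpSq_eq G hG]
  have : ∀ i, ‖X i‖ ^ 2
      = ‖X i - mean X‖ ^ 2 + 2 * inner ℝ (X i - mean X) (mean X) + ‖mean X‖ ^ 2 := fun i => by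
    rw [← norm_add_sq_real]; simp
  rw [Finset.sum_congr rfl fun i _ => this i, Finset.sum_add_distrib, Finset.sum_add_distrib,
    ← Finset.mul_sum, ← sum_inner, sum_sub_mean hN]
  simp

/-- Rayleigh quotient of a unit eigenvector, with -u_i u_j ≤ (u_i² + u_j²)/2 on every edge. It turns
a bound on hρd into h·ρμ ≤ 1/2 for all modes at once. -/
theorem lapEig_le {d : ℕ} (hd : G.maxDegree ≤ d) (l : Fin N) : lapEig G l ≤ 2 * d := by
  set u := (lap_isHermitian G).eigenvectorBasis l with hu
  have hdeg : ∀ i, (G.degree i : ℝ) ≤ d := fun i => by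
    exact_mod_cast (G.degree_le_maxDegree i).trans hd
  have h1 : ∑ i, u i * u i = 1 := by
    have := (lap_isHermitian G).eigenvectorBasis.orthonormal.1 l
    have h2 : ‖u‖ ^ 2 = 1 := by rw [hu, this]; norm_num
    rw [EuclideanSpace.norm_sq_eq] at h2
    simpa [Real.norm_eq_abs, sq_abs, ← sq] using h2
  have h2 : lapEig G l = ∑ i, u i * (lapEig G l * u i) := by
    calc lapEig G l = lapEig G l * ∑ i, u i * u i := by rw [h1, mul_one]
      _ = _ := by rw [Finset.mul_sum]; exact Finset.sum_congr rfl fun i _ => by ring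
  have h3 : ∀ i, u i * (lapEig G l * u i)
      = (G.degree i : ℝ) * (u i * u i) - ∑ j ∈ G.neighborFinset i, u i * u j := fun i => by
    rw [← lap_eigenvectorBasis, ← Finset.mul_sum]; ring
  have h4 : ∀ i, -∑ j ∈ G.neighborFinset i, u i * u j
      ≤ (G.degree i : ℝ) * (u i * u i) / 2 + (∑ j ∈ G.neighborFinset i, u j * u j) / 2 := by
    intro i
    have : (G.degree i : ℝ) * (u i * u i) = ∑ j ∈ G.neighborFinset i, u i * u i := by
      simp
    rw [this, ← add_div, ← Finset.sum_add_distrib, Finset.sum_div, ← Finset.sum_neg_distrib]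
    exact Finset.sum_le_sum fun j _ => by nlinarith [sq_nonneg (u i + u j)]
  have h5 : ∑ i, ∑ j ∈ G.neighborFinset i, u j * u j = ∑ i, (G.degree i : ℝ) * (u i * u i) := by
    rw [sum_neighborFinset_comm]; simp
  have h6 : ∑ i, (G.degree i : ℝ) * (u i * u i) ≤ d := by
    calc _ ≤ ∑ i, (d : ℝ) * (u i * u i) :=
          Finset.sum_le_sum fun i _ => mul_le_mul_of_nonneg_right (hdeg i) (mul_self_nonneg _)
      _ = d := by rw [← Finset.mul_sum, h1, mul_one]
  have h7 : ∑ i, u i * (lapEig G l * u i) ≤ 2 * ∑ i, (G.degree i : ℝ) * (u i * u i) := by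
    calc _ ≤ ∑ i, ((G.degree i : ℝ) * (u i * u i) + ((G.degree i : ℝ) * (u i * u i) / 2
            + (∑ j ∈ G.neighborFinset i, u j * u j) / 2)) :=
          Finset.sum_le_sum fun i _ => by rw [h3]; linarith [h4 i]
      _ = _ := by
          rw [Finset.sum_add_distrib, Finset.sum_add_distrib, ← Finset.sum_div, ← Finset.sum_div,
            h5]; ring
  linarith

end Spectral

/-! ### The local steps of one round and their drift -/

section Round

variable {N n : ℕ}

/-- Time average of the first `τ` terms. -/
noncomputable def timeAvg (τ : ℕ) (a : ℕ → ℝ) : ℝ := (1 / (τ : ℝ)) * ∑ t ∈ Finset.range τ, a t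

theorem timeAvg_nonneg {τ : ℕ} {a : ℕ → ℝ} (ha : ∀ t, 0 ≤ a t) : 0 ≤ timeAvg τ a :=
  mul_nonneg (by positivity) (Finset.sum_nonneg fun t _ => ha t)

theorem timeAvg_mono {τ : ℕ} {a b : ℕ → ℝ} (h : ∀ t, a t ≤ b t) : timeAvg τ a ≤ timeAvg τ b :=
  mul_le_mul_of_nonneg_left (Finset.sum_le_sum fun t _ => h t) (by positivity)

theorem timeAvg_mul_left (τ : ℕ) (c : ℝ) (a : ℕ → ℝ) :
    timeAvg τ (fun t => c * a t) = c * timeAvg τ a := by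
  simp only [timeAvg, ← Finset.mul_sum]; ring

theorem timeAvg_add (τ : ℕ) (a b : ℕ → ℝ) :
    timeAvg τ (fun t => a t + b t) = timeAvg τ a + timeAvg τ b := by
  simp only [timeAvg, Finset.sum_add_distrib]; ring

theorem timeAvg_const {τ : ℕ} (hτ : 1 ≤ τ) (c : ℝ) : timeAvg τ (fun _ => c) = c := by
  have : (τ : ℝ) ≠ 0 := by positivity
  simp [timeAvg, this]

theorem sum_eq_mul_timeAvg {τ : ℕ} (hτ : 1 ≤ τ) (a : ℕ → ℝ) :
    ∑ t ∈ Finset.range τ, a t = τ * timeAvg τ a := by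
  have : (τ : ℝ) ≠ 0 := by positivity
  simp only [timeAvg]; field_simp

theorem timeAvg_sum {ι : Type*} (s : Finset ι) (τ : ℕ) (a : ι → ℕ → ℝ) :
    ∑ i ∈ s, timeAvg τ (a i) = timeAvg τ (fun t => ∑ i ∈ s, a i t) := by
  simp only [timeAvg, ← Finset.mul_sum]
  rw [Finset.sum_comm]

theorem norm_smul_sum_sq_le {E : Type*} [NormedAddCommGroup E] [InnerProductSpace ℝ E] {τ : ℕ}
    (hτ : 1 ≤ τ) (γ : ℝ) (v : ℕ → E) :
    ‖γ • ∑ t ∈ Finset.range τ, v t‖ ^ 2 ≤ (γ * τ) ^ 2 * timeAvg τ (fun t => ‖v t‖ ^ 2) := by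
  rw [norm_smul, mul_pow, Real.norm_eq_abs, sq_abs, mul_pow, mul_assoc]
  refine mul_le_mul_of_nonneg_left ?_ (sq_nonneg _)
  have := norm_sum_sq_le_card_mul (Finset.range τ) v
  rw [Finset.card_range, sum_eq_mul_timeAvg hτ] at this
  linarith

/-- Drift of the local iterates of one agent. -/
theorem local_drift {E : Type*} [NormedAddCommGroup E] [InnerProductSpace ℝ E] {τ : ℕ}
    (hτ : 1 ≤ τ) {γ M : ℝ} {φ e ξ : ℕ → E} {p : E}
    (hstep : ∀ t, φ (t + 1) = φ t + γ • (p - e t - ξ t))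
    (he : ∀ t, ‖e t‖ ≤ M * ‖φ t - φ 0‖) :
    timeAvg τ (fun t => ‖φ t - φ 0‖ ^ 2) ≤ 3 * (γ * τ) ^ 2 * (‖p‖ ^ 2
      + M ^ 2 * timeAvg τ (fun t => ‖φ t - φ 0‖ ^ 2) + timeAvg τ (fun t => ‖ξ t‖ ^ 2)) := by
  have hsum : ∀ t, φ t - φ 0 = γ • ∑ s ∈ Finset.range t, (p - e s - ξ s) := by
    intro t
    induction t with
    | zero => simp
    | succ t ih => rw [Finset.sum_range_succ, smul_add, ← ih, hstep]; abel
  have hterm : ∀ s, ‖p - e s - ξ s‖ ^ 2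
      ≤ 3 * (‖p‖ ^ 2 + M ^ 2 * ‖φ s - φ 0‖ ^ 2 + ‖ξ s‖ ^ 2) := by
    intro s
    have h1 := norm_add_sq_le_three p (-e s) (-ξ s)
    rw [norm_neg, norm_neg, ← sub_eq_add_neg, ← sub_eq_add_neg] at h1
    have h2 : ‖e s‖ ^ 2 ≤ (M * ‖φ s - φ 0‖) ^ 2 := by gcongr; exact he s
    rw [mul_pow] at h2
    linarith
  have hone : ∀ t ∈ Finset.range τ, ‖φ t - φ 0‖ ^ 2 ≤ 3 * (γ * τ) ^ 2 * (‖p‖ ^ 2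
      + M ^ 2 * timeAvg τ (fun t => ‖φ t - φ 0‖ ^ 2) + timeAvg τ (fun t => ‖ξ t‖ ^ 2)) := by
    intro t ht
    have htτ : t ≤ τ := (Finset.mem_range.mp ht).le
    have h1 := norm_sum_sq_le_card_mul (Finset.range t) (fun s => p - e s - ξ s)
    rw [Finset.card_range] at h1
    -- Extending the sum from `t` to `τ` terms makes the bound independent of `t`. The drift remains
    -- on the right-hand side and is absorbed once γτM is small.
    have h2 : (t : ℝ) * ∑ s ∈ Finset.range t, ‖p - e s - ξ s‖ ^ 2
        ≤ τ * ∑ s ∈ Finset.range τ, ‖p - e s - ξ s‖ ^ 2 := by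
      gcongr
    have h3 := timeAvg_mono (τ := τ) hterm
    rw [timeAvg_mul_left, timeAvg_add, timeAvg_add, timeAvg_const hτ, timeAvg_mul_left] at h3
    rw [sum_eq_mul_timeAvg hτ] at h2
    rw [hsum t, norm_smul, mul_pow, Real.norm_eq_abs, sq_abs]
    calc γ ^ 2 * ‖∑ s ∈ Finset.range t, (p - e s - ξ s)‖ ^ 2
        ≤ γ ^ 2 * (τ * (τ * timeAvg τ fun s => ‖p - e s - ξ s‖ ^ 2)) :=
          mul_le_mul_of_nonneg_left (h1.trans h2) (sq_nonneg _)
      _ = (γ * τ) ^ 2 * timeAvg τ (fun s => ‖p - e s - ξ s‖ ^ 2) := by ring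
      _ ≤ (γ * τ) ^ 2 * _ := mul_le_mul_of_nonneg_left h3 (sq_nonneg _)
      _ = _ := by ring
  calc timeAvg τ (fun t => ‖φ t - φ 0‖ ^ 2)
      ≤ (1 / (τ : ℝ)) * ∑ t ∈ Finset.range τ, _ :=
        mul_le_mul_of_nonneg_left (Finset.sum_le_sum hone) (by positivity)
    _ = _ := timeAvg_const hτ _

/-- A family of monotone, `L`-Lipschitz vector fields. -/
structure IsMonoLipschitz (L : ℝ) (g : Fin N → Vec n → Vec n) : Prop where
  lip : ∀ i x y, ‖g i x - g i y‖ ≤ L * ‖x - y‖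
  mono : ∀ i x y, 0 ≤ inner ℝ (x - y) (g i x - g i y)

/-- One round of local training from `x`, driven by the vector fields `g` with errors `ξ`; `Z i` is
the sum of the auxiliary variables of agent `i`. -/
structure IsRound (G : SimpleGraph (Fin N)) [DecidableRel G.Adj] (ρ γ : ℝ)
    (g : Fin N → Vec n → Vec n) (x Z : Fin N → Vec n) (ξ φ : ℕ → Fin N → Vec n) : Prop where
  init : φ 0 = x
  step : ∀ t i, φ (t + 1) i
    = φ t i - γ • (g i (φ t i) + ξ t i + (ρ * (G.degree i : ℝ)) • φ t i - Z i)
  balance : ∑ i, Z i = ρ • ∑ i, (G.degree i : ℝ) • x i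

/-- The total drift of the local iterates. -/
noncomputable def driftSq (τ : ℕ) (x : Fin N → Vec n) (φ : ℕ → Fin N → Vec n) : ℝ :=
  timeAvg τ fun t => ∑ i, ‖φ t i - x i‖ ^ 2

/-- The total gradient noise. -/
noncomputable def noiseSq (τ : ℕ) (ξ : ℕ → Fin N → Vec n) : ℝ :=
  timeAvg τ fun t => ∑ i, ‖ξ t i‖ ^ 2

theorem driftSq_nonneg (τ : ℕ) (x : Fin N → Vec n) (φ : ℕ → Fin N → Vec n) : 0 ≤ driftSq τ x φ :=
  timeAvg_nonneg fun _ => by positivity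

theorem noiseSq_nonneg (τ : ℕ) (ξ : ℕ → Fin N → Vec n) : 0 ≤ noiseSq τ ξ :=
  timeAvg_nonneg fun _ => by positivity

theorem mean_add (X Y : Fin N → Vec n) : mean (X + Y) = mean X + mean Y := by
  simp [mean, Finset.sum_add_distrib]

theorem mean_sub (X Y : Fin N → Vec n) : mean (X - Y) = mean X - mean Y := by
  simp [mean, Finset.sum_sub_distrib, smul_sub]

theorem mean_smul (c : ℝ) (X : Fin N → Vec n) : mean (c • X) = c • mean X := by
  simp only [mean, Pi.smul_apply, ← Finset.smul_sum]
  rw [smul_comm]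

theorem mean_sum {ι : Type*} (s : Finset ι) (X : ι → Fin N → Vec n) :
    mean (∑ t ∈ s, X t) = ∑ t ∈ s, mean (X t) := by
  simp only [mean, Finset.sum_apply, ← Finset.smul_sum]
  rw [Finset.sum_comm]

theorem mul_norm_mean_sq_le (hN : 0 < N) (X : Fin N → Vec n) :
    N * ‖mean X‖ ^ 2 ≤ ∑ i, ‖X i‖ ^ 2 := by
  have h := norm_sum_sq_le_card_mul Finset.univ X
  have hN' : (0 : ℝ) < N := by positivity
  rw [Finset.card_univ, Fintype.card_fin] at h
  simp only [mean, norm_smul, mul_pow]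
  rw [Real.norm_eq_abs, sq_abs]
  have : (N : ℝ) * ((1 / (N : ℝ)) ^ 2 * ‖∑ i, X i‖ ^ 2) = ‖∑ i, X i‖ ^ 2 / N := by
    field_simp
  rw [this, div_le_iff₀ hN']
  linarith

/-- The average of the vector fields at a common point. -/
noncomputable def meanField (g : Fin N → Vec n → Vec n) (y : Vec n) : Vec n :=
  mean fun i => g i y

theorem mul_norm_mean_field_sub_sq_le (hN : 0 < N) {L : ℝ} {g : Fin N → Vec n → Vec n}
    (hg : IsMonoLipschitz L g) (X : Fin N → Vec n) (y : Vec n) :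
    N * ‖mean (fun i => g i (X i)) - meanField g y‖ ^ 2 ≤ L ^ 2 * ∑ i, ‖X i - y‖ ^ 2 := by
  rw [meanField, ← mean_sub]
  refine (mul_norm_mean_sq_le hN _).trans ?_
  rw [Finset.mul_sum]
  refine Finset.sum_le_sum fun i _ => ?_
  rw [← mul_pow]
  have := hg.lip i (X i) y
  simp only [Pi.sub_apply]
  gcongr

/-- The part of the auxiliary variables that is not determined by the dual variable `ω`. -/
noncomputable def auxResidual (G : SimpleGraph (Fin N)) [DecidableRel G.Adj] (ρ : ℝ)
    (x Z ω : Fin N → Vec n) : Fin N → Vec n :=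
  fun i => Z i - (ρ * (G.degree i : ℝ)) • x i - ω i + (ρ / 2) • lapOp G x i

/-- Energy of the deviation from consensus. -/
noncomputable def energy (G : SimpleGraph (Fin N)) [DecidableRel G.Adj] (ρ h : ℝ)
    (g : Fin N → Vec n → Vec n) (x ω : Fin N → Vec n) : ℝ :=
  ∑ l ∈ modes G, (1 / 2 * ‖modeComponent G l x‖ ^ 2
    + h / (ρ * lapEig G l) * ‖modeComponent G l (fun i => ω i - g i (mean x))‖ ^ 2)

section

variable {G : SimpleGraph (Fin N)} [DecidableRel G.Adj] {L ρ γ lam : ℝ} {d τ : ℕ}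
  {g : Fin N → Vec n → Vec n} {x Z : Fin N → Vec n} {ξ φ : ℕ → Fin N → Vec n}

/-- The direction of the local steps at the start of the round. -/
noncomputable def roundDir (G : SimpleGraph (Fin N)) [DecidableRel G.Adj] (ρ : ℝ)
    (g : Fin N → Vec n → Vec n) (x Z : Fin N → Vec n) : Fin N → Vec n :=
  fun i => Z i - (ρ * (G.degree i : ℝ)) • x i - g i (x i)

/-- The change of the local direction since the start of the round. -/
noncomputable def dirChange (G : SimpleGraph (Fin N)) [DecidableRel G.Adj] (ρ : ℝ)
    (g : Fin N → Vec n → Vec n) (x : Fin N → Vec n) (φ : ℕ → Fin N → Vec n) (t : ℕ) :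
    Fin N → Vec n :=
  fun i => (g i (φ t i) - g i (x i)) + (ρ * (G.degree i : ℝ)) • (φ t i - x i)

/-- The averaged change of the local direction. -/
noncomputable def meanChange (G : SimpleGraph (Fin N)) [DecidableRel G.Adj] (ρ : ℝ) (τ : ℕ)
    (g : Fin N → Vec n → Vec n) (x : Fin N → Vec n) (φ : ℕ → Fin N → Vec n) : Fin N → Vec n :=
  fun i => -((1 / (τ : ℝ)) • ∑ t ∈ Finset.range τ, dirChange G ρ g x φ t i)

/-- The accumulated gradient noise of a round. -/
noncomputable def roundNoise (γ : ℝ) (τ : ℕ) (ξ : ℕ → Fin N → Vec n) : Fin N → Vec n :=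
  fun i => γ • ∑ t ∈ Finset.range τ, ξ t i

theorem norm_dirChange_le (hρ : 0 < ρ) (hd : G.maxDegree ≤ d) (hg : IsMonoLipschitz L g) (t : ℕ)
    (i : Fin N) : ‖dirChange G ρ g x φ t i‖ ≤ (L + ρ * d) * ‖φ t i - x i‖ := by
  have hdeg : (G.degree i : ℝ) ≤ d := by exact_mod_cast (G.degree_le_maxDegree i).trans hd
  refine (norm_add_le _ _).trans ?_
  rw [add_mul, norm_smul, Real.norm_of_nonneg (by positivity)]
  exact add_le_add (hg.lip i _ _) (by gcongr)

theorem IsRound.step' (hr : IsRound G ρ γ g x Z ξ φ) (t : ℕ) (i : Fin N) :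
    φ (t + 1) i = φ t i + γ • (roundDir G ρ g x Z i - dirChange G ρ g x φ t i - ξ t i) := by
  rw [hr.step, sub_eq_add_neg, ← smul_neg]
  congr 2
  simp only [roundDir, dirChange, smul_sub]
  abel

/-- Freezing the direction at the start of the round makes the `τ` local steps look like a single
step of length γτ; the drift enters only through `meanChange`. -/
theorem IsRound.displacement (hr : IsRound G ρ γ g x Z ξ φ) (hτ : 1 ≤ τ) :
    φ τ - x = (γ * τ) • (roundDir G ρ g x Z + meanChange G ρ τ g x φ) - roundNoise γ τ ξ := by
  funext i
  have hτ' : (τ : ℝ) ≠ 0 := by positivity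
  have hsum : ∀ t, φ t i - x i = γ • ∑ s ∈ Finset.range t,
      (roundDir G ρ g x Z i - dirChange G ρ g x φ s i - ξ s i) := by
    intro t
    induction t with
    | zero => simp [hr.init]
    | succ t ih => rw [Finset.sum_range_succ, smul_add, ← ih, hr.step']; abel
  simp only [Pi.sub_apply, Pi.smul_apply, Pi.add_apply, hsum τ, meanChange, roundNoise,
    Finset.sum_sub_distrib, Finset.sum_const, Finset.card_range, smul_add, smul_sub, smul_neg,
    smul_smul, ← Nat.cast_smul_eq_nsmul ℝ]
  rw [show γ * τ * (1 / (τ : ℝ)) = γ by field_simp]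
  abel

theorem sum_norm_meanChange_sq_le (hρ : 0 < ρ) (hτ : 1 ≤ τ) (hd : G.maxDegree ≤ d)
    (hg : IsMonoLipschitz L g) :
    ∑ i, ‖meanChange G ρ τ g x φ i‖ ^ 2 ≤ (L + ρ * d) ^ 2 * driftSq τ x φ := by
  have hτ' : (τ : ℝ) ≠ 0 := by positivity
  rw [driftSq, ← timeAvg_sum, Finset.mul_sum]
  refine Finset.sum_le_sum fun i _ => ?_
  rw [meanChange, norm_neg, ← timeAvg_mul_left]
  refine (norm_smul_sum_sq_le hτ _ _).trans ?_
  rw [show 1 / (τ : ℝ) * τ = 1 by field_simp, one_pow, one_mul]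
  refine timeAvg_mono fun t => ?_
  rw [← mul_pow]
  have := norm_dirChange_le (x := x) (φ := φ) hρ hd hg t i
  gcongr

theorem sum_norm_roundNoise_sq_le (hτ : 1 ≤ τ) :
    ∑ i, ‖roundNoise γ τ ξ i‖ ^ 2 ≤ (γ * τ) ^ 2 * noiseSq τ ξ := by
  rw [noiseSq, ← timeAvg_sum, Finset.mul_sum]
  exact Finset.sum_le_sum fun i _ => norm_smul_sum_sq_le hτ _ _

/-- By the balance condition the auxiliary variables and the degree terms cancel in the mean. -/
theorem mean_roundDir (hr : IsRound G ρ γ g x Z ξ φ) :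
    mean (roundDir G ρ g x Z) = -mean (fun i => g i (x i)) := by
  have h : ∑ i, (Z i - (ρ * (G.degree i : ℝ)) • x i) = 0 := by
    rw [Finset.sum_sub_distrib, hr.balance, Finset.smul_sum]
    simp [smul_smul]
  simp only [mean, roundDir, Finset.sum_sub_distrib (f := fun i => Z i - _), h]
  simp

theorem driftSq_le_of_dir (hr : IsRound G ρ γ g x Z ξ φ) (hρ : 0 < ρ) (hτ : 1 ≤ τ)
    (hd : G.maxDegree ≤ d) (hg : IsMonoLipschitz L g) :
    driftSq τ x φ ≤ 3 * (γ * τ) ^ 2 * (∑ i, ‖roundDir G ρ g x Z i‖ ^ 2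
      + (L + ρ * d) ^ 2 * driftSq τ x φ + noiseSq τ ξ) := by
  simp only [driftSq, noiseSq, ← timeAvg_sum, Finset.mul_sum, ← Finset.sum_add_distrib]
  refine Finset.sum_le_sum fun i _ => ?_
  have h := local_drift hτ (φ := fun t => φ t i) (p := roundDir G ρ g x Z i)
    (e := fun t => dirChange G ρ g x φ t i) (ξ := fun t => ξ t i) (γ := γ) (M := L + ρ * d)
    (fun t => hr.step' t i) (fun t => by
      simp only [hr.init]; exact norm_dirChange_le hρ hd hg t i)
  simpa only [hr.init] using h

end

end Round

/-! ### One-round estimates for the consensus energy, the drift and the cost -/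

section RoundEnergy

variable {N n : ℕ} {G : SimpleGraph (Fin N)} [DecidableRel G.Adj] {L ρ γ lam : ℝ} {d τ : ℕ}
  {g : Fin N → Vec n → Vec n} {x Z : Fin N → Vec n} {ξ φ : ℕ → Fin N → Vec n}

theorem perpSq_add_le (X Y : Fin N → Vec n) :
    perpSq G (X + Y) ≤ 2 * (perpSq G X + perpSq G Y) := by
  simp only [perpSq, ← Finset.sum_add_distrib, Finset.mul_sum, modeComponent_add]
  exact Finset.sum_le_sum fun l _ => norm_add_sq_le_two _ _

theorem perpSq_const_smul (c : ℝ) (X : Fin N → Vec n) :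
    perpSq G (c • X) = c ^ 2 * perpSq G X := by
  simp only [perpSq, Finset.mul_sum, modeComponent_smul, norm_smul, mul_pow, Real.norm_eq_abs,
    sq_abs]

/-- Decrease of the consensus energy in one round. -/
theorem IsRound.energy_le (hr : IsRound G ρ γ g x Z ξ φ) (hG : G.Connected)
    (hρ : 0 < ρ) (hlam : 0 < lam) (hγ : 0 < γ) (hτ : 1 ≤ τ) (hd : G.maxDegree ≤ d)
    (hgap : ∀ l, lapEig G l ≠ 0 → lam ≤ lapEig G l) (hg : IsMonoLipschitz L g)
    (h1 : 4 * (γ * τ) * (ρ * d) ≤ 1) (h2 : 80 * L ^ 2 * (γ * τ) ≤ ρ * lam)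
    (ω ω' : Fin N → Vec n) (hω : ω' = ω - (ρ / 2) • lapOp G (φ τ)) :
    energy G ρ (γ * τ) g (φ τ) ω' ≤ energy G ρ (γ * τ) g x ω
      - (γ * τ) * (ρ * lam) / 8 * perpSq G x - 1 / 8 * perpSq G (φ τ - x)
      - ∑ i, inner ℝ (x i - mean x) (roundNoise γ τ ξ i)
      + 16 * (γ * τ) / (ρ * lam) * ((L + ρ * d) ^ 2 * driftSq τ x φ
        + perpSq G (auxResidual G ρ x Z ω))
      + 5 * ((γ * τ) ^ 2 * noiseSq τ ξ)
      + 65 / (ρ * lam) ^ 2 * (L ^ 2 * (N * ‖mean (φ τ) - mean x‖ ^ 2)) := by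
  have hN : 0 < N := Fin.pos_iff_nonempty.mpr hG.nonempty
  set h := γ * τ with hh
  have hτ' : (0 : ℝ) < τ := by exact_mod_cast hτ
  have hpos : 0 < h := by positivity
  set W : Fin N → Vec n := fun i => ω i - g i (mean x) with hW
  set Gd : Fin N → Vec n := fun i => g i (x i) - g i (mean x) with hGd
  set q : Fin N → Vec n := meanChange G ρ τ g x φ + auxResidual G ρ x Z ω with hq
  set ν := roundNoise γ τ ξ with hν
  set η : Fin N → Vec n := fun i => g i (mean (φ τ)) - g i (mean x) with hη
  -- The drift and the residual of the auxiliary variables are both put into `q`, so that the round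
  -- takes the form treated in `mode_energy_step`.
  have hD : φ τ - x = h • (W - (ρ / 2) • lapOp G x - Gd + q) - ν := by
    rw [hr.displacement hτ]
    congr 2
    funext i
    simp only [hW, hGd, hq, Pi.add_apply, Pi.sub_apply, Pi.smul_apply, roundDir, auxResidual]
    abel
  have hW' : (fun i => ω' i - g i (mean (φ τ))) = W - (ρ / 2) • lapOp G (φ τ) - η := by
    funext i
    simp only [hW, hη, hω, Pi.sub_apply, Pi.smul_apply]
    abel
  have hmode : ∀ l ∈ modes G, 1 / 2 * ‖modeComponent G l (φ τ)‖ ^ 2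
      + h / (ρ * lapEig G l) * ‖modeComponent G l (fun i => ω' i - g i (mean (φ τ)))‖ ^ 2
      ≤ (1 / 2 * ‖modeComponent G l x‖ ^ 2 + h / (ρ * lapEig G l) * ‖modeComponent G l W‖ ^ 2)
        - 3 * (h * (ρ * lam)) / 16 * ‖modeComponent G l x‖ ^ 2
        - 1 / 8 * ‖modeComponent G l (φ τ - x)‖ ^ 2
        - inner ℝ (modeComponent G l x) (modeComponent G l ν)
        - h * inner ℝ (modeComponent G l x) (modeComponent G l Gd)
        + 5 * h ^ 2 * ‖modeComponent G l Gd‖ ^ 2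
        + 8 * h / (ρ * lam) * ‖modeComponent G l q‖ ^ 2
        + 5 * ‖modeComponent G l ν‖ ^ 2
        + 65 / (ρ * lam) ^ 2 * ‖modeComponent G l η‖ ^ 2 := by
    intro l hl
    have hl0 := (mem_modes G).mp hl
    have hle := hgap l hl0
    have hμ : 0 < lapEig G l := hlam.trans_le hle
    have hc : 0 < ρ * lapEig G l := by positivity
    have hcl : ρ * lam ≤ ρ * lapEig G l := by gcongr
    have hhc : h * (ρ * lapEig G l) ≤ 1 / 2 := by
      have := lapEig_le G hd l
      have : h * (ρ * lapEig G l) ≤ h * (ρ * (2 * d)) := by gcongr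
      linarith
    have e1 : modeComponent G l (φ τ)
        = modeComponent G l x + modeComponent G l (φ τ - x) := by
      rw [← modeComponent_add]; simp
    have e2 : modeComponent G l (φ τ - x) = h • (modeComponent G l W
        - (ρ * lapEig G l / 2) • modeComponent G l x - modeComponent G l Gd
        + modeComponent G l q) - modeComponent G l ν := by
      rw [hD, modeComponent_sub, modeComponent_smul, modeComponent_add, modeComponent_sub,
        modeComponent_sub, modeComponent_smul, modeComponent_lapOp, smul_smul]
      congr 6; ring
    have e3 : modeComponent G l (fun i => ω' i - g i (mean (φ τ)))
        = modeComponent G l W - (ρ * lapEig G l / 2) • (modeComponent G l x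
          + modeComponent G l (φ τ - x)) - modeComponent G l η := by
      rw [hW', modeComponent_sub, modeComponent_sub, modeComponent_smul, modeComponent_lapOp,
        smul_smul, ← e1]
      congr 3; ring
    have key := mode_energy_step hpos hc hhc (η := modeComponent G l η) e2
    rw [← e3, ← e1] at key
    have k1 : 3 * (h * (ρ * lam)) / 16 * ‖modeComponent G l x‖ ^ 2
        ≤ 3 * (h * (ρ * lapEig G l)) / 16 * ‖modeComponent G l x‖ ^ 2 := by gcongr
    have k2 : 8 * h / (ρ * lapEig G l) * ‖modeComponent G l q‖ ^ 2
        ≤ 8 * h / (ρ * lam) * ‖modeComponent G l q‖ ^ 2 := by gcongr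
    have k3 : 65 / (ρ * lapEig G l) ^ 2 * ‖modeComponent G l η‖ ^ 2
        ≤ 65 / (ρ * lam) ^ 2 * ‖modeComponent G l η‖ ^ 2 := by gcongr
    linarith
  have hsum := Finset.sum_le_sum hmode
  simp only [Finset.sum_add_distrib, Finset.sum_sub_distrib, ← Finset.mul_sum] at hsum
  rw [sum_modes_inner G hG x ν, sum_modes_inner G hG x Gd] at hsum
  change _ ≤ _ - _ * perpSq G x - _ * perpSq G (φ τ - x) - _ - _ + _ * perpSq G Gd
    + _ * perpSq G q + _ * perpSq G ν + _ * perpSq G η at hsum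
  -- Convexity, used only after summation over the modes. Bounding this term by Cauchy–Schwarz would
  -- cost hL‖X‖², which the damping, of order hρλ, need not cover.
  have hmono : 0 ≤ ∑ i, inner ℝ (x i - mean x) (Gd i) :=
    Finset.sum_nonneg fun i _ => hg.mono i _ _
  have hGd2 : perpSq G Gd ≤ L ^ 2 * perpSq G x := by
    refine (perpSq_le G Gd).trans ?_
    rw [perpSq_eq G hG x, Finset.mul_sum]
    refine Finset.sum_le_sum fun i _ => ?_
    rw [← mul_pow]
    have := hg.lip i (x i) (mean x)
    simp only [hGd]
    gcongr
  have hη2 : perpSq G η ≤ L ^ 2 * (N * ‖mean (φ τ) - mean x‖ ^ 2) := by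
    refine (perpSq_le G η).trans ?_
    have : ∀ i ∈ Finset.univ, ‖η i‖ ^ 2 ≤ (L * ‖mean (φ τ) - mean x‖) ^ 2 := fun i _ => by
      have := hg.lip i (mean (φ τ)) (mean x)
      simp only [hη]
      gcongr
    refine (Finset.sum_le_sum this).trans_eq ?_
    simp; ring
  have hν2 : perpSq G ν ≤ h ^ 2 * noiseSq τ ξ :=
    (perpSq_le G ν).trans (sum_norm_roundNoise_sq_le hτ)
  have hq2 : perpSq G q ≤ 2 * ((L + ρ * d) ^ 2 * driftSq τ x φ
      + perpSq G (auxResidual G ρ x Z ω)) := by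
    refine (perpSq_add_le _ _).trans ?_
    have := (perpSq_le G _).trans (sum_norm_meanChange_sq_le (x := x) (φ := φ) hρ hτ hd hg)
    linarith
  -- With ℓ = ρλ, the condition `h2` charges this to hℓ/16 of the damping 3hℓ/16, which leaves hℓ/8.
  have j1 : 5 * h ^ 2 * perpSq G Gd ≤ h * (ρ * lam) / 16 * perpSq G x := by
    have a1 := mul_le_mul_of_nonneg_left hGd2 (show 0 ≤ 5 * h ^ 2 by positivity)
    have a2 := mul_le_mul_of_nonneg_right h2 (show 0 ≤ h / 16 * perpSq G x from
      mul_nonneg (by positivity) (perpSq_nonneg G x))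
    linarith
  have j2 := mul_le_mul_of_nonneg_left hq2 (show 0 ≤ 8 * h / (ρ * lam) by positivity)
  have j3 := mul_le_mul_of_nonneg_left hη2 (show 0 ≤ 65 / (ρ * lam) ^ 2 by positivity)
  have j4 := mul_nonneg hpos.le hmono
  have j5 : 8 * h / (ρ * lam) * (2 * ((L + ρ * d) ^ 2 * driftSq τ x φ
      + perpSq G (auxResidual G ρ x Z ω))) = 16 * h / (ρ * lam) * ((L + ρ * d) ^ 2 * driftSq τ x φ
      + perpSq G (auxResidual G ρ x Z ω)) := by ring
  have hE : energy G ρ h g (φ τ) ω' = 1 / 2 * ∑ i ∈ modes G, ‖modeComponent G i (φ τ)‖ ^ 2 +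
      ∑ l ∈ modes G, h / (ρ * lapEig G l)
        * ‖modeComponent G l (fun i => ω' i - g i (mean (φ τ)))‖ ^ 2 := by
    simp only [energy, Finset.sum_add_distrib, ← Finset.mul_sum]
  have hE0 : energy G ρ h g x ω = 1 / 2 * ∑ i ∈ modes G, ‖modeComponent G i x‖ ^ 2 +
      ∑ l ∈ modes G, h / (ρ * lapEig G l) * ‖modeComponent G l W‖ ^ 2 := by
    simp only [energy, Finset.sum_add_distrib, ← Finset.mul_sum, hW]
  rw [hE, hE0]
  linarith

/-- The local drift is controlled by the displacement of the round and by the gradients. -/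
theorem IsRound.driftSq_le (hr : IsRound G ρ γ g x Z ξ φ) (hG : G.Connected) (hL : 0 < L)
    (hρ : 0 < ρ) (hγ : 0 < γ) (hτ : 1 ≤ τ) (hd : G.maxDegree ≤ d) (hg : IsMonoLipschitz L g)
    (h1 : 6 * (γ * τ) * (L + ρ * d) ≤ 1) :
    driftSq τ x φ ≤ 36 * perpSq G (φ τ - x) + 48 * ((γ * τ) ^ 2 * noiseSq τ ξ)
      + 24 * (γ * τ) ^ 2 * (N * ‖meanField g (mean x)‖ ^ 2 + L ^ 2 * perpSq G x) := by
  have hN : 0 < N := Fin.pos_iff_nonempty.mpr hG.nonempty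
  set h := γ * τ with hh
  have hτ' : (0 : ℝ) < τ := by exact_mod_cast hτ
  have hpos : 0 < h := by positivity
  set M := L + ρ * d with hM
  have hMpos : 0 < M := by positivity
  have hS := driftSq_le_of_dir hr hρ hτ hd hg
  rw [sum_norm_sq_eq G hG, mean_roundDir hr, norm_neg, ← hM, ← hh] at hS
  set p := roundDir G ρ g x Z with hp
  set r := meanChange G ρ τ g x φ with hr'
  set ν := roundNoise γ τ ξ with hν
  have hS0 := driftSq_nonneg τ x φ
  have hΞ0 := noiseSq_nonneg τ ξ
  -- The direction contains the dual variable, for which no bound is available. Its deviation part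
  -- is read off the displacement of the round instead; its mean part is a mean gradient.
  have hperp : h ^ 2 * perpSq G p ≤ 3 * (perpSq G (φ τ - x)
      + h ^ 2 * (M ^ 2 * driftSq τ x φ) + h ^ 2 * noiseSq τ ξ) := by
    have e : h • p = (φ τ - x) + (-h) • r + ν := by
      rw [hr.displacement hτ, smul_add, neg_smul]; abel
    have b1 : perpSq G ((φ τ - x) + (-h) • r + ν)
        ≤ 3 * (perpSq G (φ τ - x) + perpSq G ((-h) • r) + perpSq G ν) := by
      simp only [perpSq, ← Finset.sum_add_distrib, Finset.mul_sum, modeComponent_add]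
      exact Finset.sum_le_sum fun l _ => norm_add_sq_le_three _ _ _
    rw [← e, perpSq_const_smul, perpSq_const_smul, neg_sq] at b1
    have b2 := (perpSq_le G r).trans (sum_norm_meanChange_sq_le hρ hτ hd hg)
    have b3 := (perpSq_le G ν).trans (sum_norm_roundNoise_sq_le hτ)
    have b4 := mul_le_mul_of_nonneg_left b2 (sq_nonneg h)
    linarith
  have hmean : N * ‖mean (fun i => g i (x i))‖ ^ 2
      ≤ 2 * (N * ‖meanField g (mean x)‖ ^ 2 + L ^ 2 * perpSq G x) := by
    have b1 := norm_add_sq_le_two (mean (fun i => g i (x i)) - meanField g (mean x))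
      (meanField g (mean x))
    rw [sub_add_cancel] at b1
    have b2 := mul_norm_mean_field_sub_sq_le hN hg x (mean x)
    rw [← perpSq_eq G hG] at b2
    have b3 := mul_le_mul_of_nonneg_left b1 (show (0 : ℝ) ≤ N by positivity)
    linarith
  -- The drift occurs on the right with total coefficient 12h²M² ≤ 1/3, so it can be moved to the
  -- left.
  have hsmall : h ^ 2 * M ^ 2 ≤ 1 / 36 := by
    have : h * M ≤ 1 / 6 := by linarith
    have h0 : 0 ≤ h * M := by positivity
    nlinarith
  have c1 := mul_le_mul_of_nonneg_right hsmall hS0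
  have c2 := mul_le_mul_of_nonneg_left hmean (sq_nonneg h)
  have c3 : 0 ≤ perpSq G (φ τ - x) := perpSq_nonneg _ _
  have c4 : 0 ≤ h ^ 2 * noiseSq τ ξ := by positivity
  have c5 : 0 ≤ h ^ 2 * (N * ‖meanField g (mean x)‖ ^ 2 + L ^ 2 * perpSq G x) :=
    mul_nonneg (sq_nonneg _) (add_nonneg (by positivity)
      (mul_nonneg (sq_nonneg _) (perpSq_nonneg _ _)))
  linarith

/-- The part of the displacement of the mean that is caused by the graph coupling. -/
noncomputable def meanCoupling (G : SimpleGraph (Fin N)) [DecidableRel G.Adj] (ρ : ℝ) (τ : ℕ)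
    (x : Fin N → Vec n) (φ : ℕ → Fin N → Vec n) : Vec n :=
  mean fun i => -((1 / (τ : ℝ)) • ∑ t ∈ Finset.range τ, (ρ * (G.degree i : ℝ)) • (φ t i - x i))

/-- The gradients are kept at the local iterates because the squares of their means are part of the
metric. The remaining coupling term comes from the drift weighted by the degrees. -/
theorem IsRound.mean_displacement (hr : IsRound G ρ γ g x Z ξ φ) (hτ : 1 ≤ τ) :
    mean (φ τ) - mean x = -(γ • ∑ t ∈ Finset.range τ, mean (fun i => g i (φ t i)))
      + (γ * τ) • meanCoupling G ρ τ x φ - mean (roundNoise γ τ ξ) := by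
  have hτ' : (τ : ℝ) ≠ 0 := by positivity
  rw [← mean_sub, hr.displacement hτ, mean_sub, mean_smul, mean_add, mean_roundDir hr]
  congr 1
  have e : meanChange G ρ τ g x φ = (fun i => g i (x i))
      - (1 / (τ : ℝ)) • (∑ t ∈ Finset.range τ, fun i => g i (φ t i))
      + (fun i => -((1 / (τ : ℝ)) • ∑ t ∈ Finset.range τ,
          (ρ * (G.degree i : ℝ)) • (φ t i - x i))) := by
    funext i
    simp only [meanChange, dirChange, Pi.add_apply, Pi.sub_apply, Pi.smul_apply,
      Finset.sum_add_distrib, Finset.sum_sub_distrib, Finset.sum_const, Finset.card_range,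
      smul_add, smul_sub, ← Nat.cast_smul_eq_nsmul ℝ, smul_smul, Finset.sum_apply]
    rw [show 1 / (τ : ℝ) * τ = 1 by field_simp, one_smul]
    abel
  rw [e, mean_add, mean_sub, mean_smul, mean_sum, ← meanCoupling]
  simp only [smul_add, smul_sub, smul_smul, smul_neg]
  rw [show γ * τ * (1 / (τ : ℝ)) = γ by field_simp]
  abel

theorem mul_norm_meanCoupling_sq_le (hN : 0 < N) (hρ : 0 < ρ) (hτ : 1 ≤ τ)
    (hd : G.maxDegree ≤ d) :
    N * ‖meanCoupling G ρ τ x φ‖ ^ 2 ≤ (ρ * d) ^ 2 * driftSq τ x φ := by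
  have hτ' : (τ : ℝ) ≠ 0 := by positivity
  refine (mul_norm_mean_sq_le hN _).trans ?_
  rw [driftSq, ← timeAvg_sum, Finset.mul_sum]
  refine Finset.sum_le_sum fun i _ => ?_
  have hdeg : (G.degree i : ℝ) ≤ d := by exact_mod_cast (G.degree_le_maxDegree i).trans hd
  rw [norm_neg, ← timeAvg_mul_left]
  refine (norm_smul_sum_sq_le hτ _ _).trans ?_
  rw [show 1 / (τ : ℝ) * τ = 1 by field_simp, one_pow, one_mul]
  refine timeAvg_mono fun t => ?_
  rw [norm_smul, Real.norm_of_nonneg (by positivity), mul_pow]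
  gcongr

/-- The average squared mean gradient along the local iterates. -/
noncomputable def gradSq (τ : ℕ) (g : Fin N → Vec n → Vec n) (φ : ℕ → Fin N → Vec n) : ℝ :=
  timeAvg τ fun t => ‖mean (fun i => g i (φ t i))‖ ^ 2

theorem IsRound.mean_displacement_sq_le (hr : IsRound G ρ γ g x Z ξ φ) (hG : G.Connected)
    (hρ : 0 < ρ) (hτ : 1 ≤ τ) (hd : G.maxDegree ≤ d) :
    N * ‖mean (φ τ) - mean x‖ ^ 2 ≤ 3 * (γ * τ) ^ 2 * (N * gradSq τ g φ
      + (ρ * d) ^ 2 * driftSq τ x φ + noiseSq τ ξ) := by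
  have hN : 0 < N := Fin.pos_iff_nonempty.mpr hG.nonempty
  rw [hr.mean_displacement hτ, sub_eq_add_neg]
  have h1 := norm_add_sq_le_three (-(γ • ∑ t ∈ Finset.range τ, mean (fun i => g i (φ t i))))
    ((γ * τ) • meanCoupling G ρ τ x φ) (-mean (roundNoise γ τ ξ))
  rw [norm_neg, norm_neg, norm_smul (γ * τ), mul_pow, Real.norm_eq_abs, sq_abs] at h1
  have h2 := norm_smul_sum_sq_le hτ γ (fun t => mean (fun i => g i (φ t i)))
  have h3 := mul_norm_meanCoupling_sq_le (x := x) (φ := φ) hN hρ hτ hd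
  have h4 := (mul_norm_mean_sq_le hN _).trans (sum_norm_roundNoise_sq_le (γ := γ) (ξ := ξ) hτ)
  have hN0 : (0 : ℝ) ≤ N := by positivity
  have h5 := mul_le_mul_of_nonneg_left h1 hN0
  have h6 := mul_le_mul_of_nonneg_left h2 hN0
  have h7 := mul_le_mul_of_nonneg_left h3 (sq_nonneg (γ * τ))
  refine h5.trans ?_
  have e : gradSq τ g φ = timeAvg τ fun t => ‖mean (fun i => g i (φ t i))‖ ^ 2 := rfl
  rw [← e] at h6
  linarith

/-- Descent of the average cost in one round. -/
theorem IsRound.cost_le (hr : IsRound G ρ γ g x Z ξ φ) (hG : G.Connected) (hL : 0 < L)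
    (hρ : 0 < ρ) (hγ : 0 < γ) (hτ : 1 ≤ τ) (hd : G.maxDegree ≤ d) (hg : IsMonoLipschitz L g)
    {F : Vec n → ℝ}
    (hF : ∀ u v, F v ≤ F u + inner ℝ (meanField g u) (v - u) + L * ‖v - u‖ ^ 2)
    (h1 : γ * τ ≤ 1) :
    N * F (mean (φ τ)) ≤ N * F (mean x)
      - N * inner ℝ (meanField g (mean x)) (mean (roundNoise γ τ ξ))
      - 3 * (γ * τ) / 8 * (N * ‖meanField g (mean x)‖ ^ 2) - (γ * τ) / 2 * (N * gradSq τ g φ)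
      + 3 * L * (γ * τ) ^ 2 * (N * gradSq τ g φ)
      + (γ * τ) * (L ^ 2 * perpSq G x
        + (L ^ 2 + 2 * (ρ * d) ^ 2 + 3 * L * (ρ * d) ^ 2) * driftSq τ x φ)
      + 3 * L * ((γ * τ) ^ 2 * noiseSq τ ξ) := by
  have hN : 0 < N := Fin.pos_iff_nonempty.mpr hG.nonempty
  have hN0 : (0 : ℝ) ≤ N := by positivity
  have hτ' : (0 : ℝ) < τ := by exact_mod_cast hτ
  set h := γ * τ with hh
  have hpos : 0 < h := by positivity
  set u := meanField g (mean x) with hu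
  have hdesc := mul_le_mul_of_nonneg_left (hF (mean x) (mean (φ τ))) hN0
  have hsq := hr.mean_displacement_sq_le hG hρ hτ hd
  rw [← hh] at hsq
  have hinner : inner ℝ u (mean (φ τ) - mean x)
      = -(γ * ∑ t ∈ Finset.range τ, inner ℝ u (mean (fun i => g i (φ t i))))
        + h * inner ℝ u (meanCoupling G ρ τ x φ) - inner ℝ u (mean (roundNoise γ τ ξ)) := by
    rw [hr.mean_displacement hτ, inner_sub_right, inner_add_right, inner_neg_right,
      inner_smul_right, inner_smul_right, inner_sum]
  -- Polarization gives both negative squares of the metric at once, at the price of the distance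
  -- between the two mean gradients.
  have hpol : ∀ t, -inner ℝ u (mean (fun i => g i (φ t i)))
      = -(1 / 2) * ‖u‖ ^ 2 + ((-(1 / 2)) * ‖mean (fun i => g i (φ t i))‖ ^ 2
        + 1 / 2 * ‖mean (fun i => g i (φ t i)) - u‖ ^ 2) := by
    intro t
    rw [norm_sub_sq_real, real_inner_comm]; ring
  have hgrad : -(γ * ∑ t ∈ Finset.range τ, inner ℝ u (mean (fun i => g i (φ t i))))
      = h * (-(1 / 2) * ‖u‖ ^ 2 + (-(1 / 2) * gradSq τ g φ
        + 1 / 2 * timeAvg τ (fun t => ‖mean (fun i => g i (φ t i)) - u‖ ^ 2))) := by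
    rw [← mul_neg, ← Finset.sum_neg_distrib, sum_eq_mul_timeAvg hτ, ← mul_assoc, ← hh]
    congr 1
    rw [gradSq, ← timeAvg_mul_left, ← timeAvg_mul_left, ← timeAvg_add]
    conv_rhs => rw [← timeAvg_const hτ (-(1 / 2) * ‖u‖ ^ 2), ← timeAvg_add]
    exact congrArg _ (funext hpol)
  have hdev : N * timeAvg τ (fun t => ‖mean (fun i => g i (φ t i)) - u‖ ^ 2)
      ≤ 2 * L ^ 2 * (perpSq G x + driftSq τ x φ) := by
    have b : ∀ t, N * ‖mean (fun i => g i (φ t i)) - u‖ ^ 2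
        ≤ 2 * L ^ 2 * perpSq G x + 2 * L ^ 2 * ∑ i, ‖φ t i - x i‖ ^ 2 := by
      intro t
      refine (mul_norm_mean_field_sub_sq_le hN hg _ _).trans ?_
      have : ∑ i, ‖φ t i - mean x‖ ^ 2 ≤ 2 * (perpSq G x + ∑ i, ‖φ t i - x i‖ ^ 2) := by
        rw [perpSq_eq G hG, ← Finset.sum_add_distrib, Finset.mul_sum]
        refine Finset.sum_le_sum fun i _ => ?_
        have := norm_add_sq_le_two (x i - mean x) (φ t i - x i)
        rwa [sub_add_sub_comm, add_comm (x i), add_sub_add_right_eq_sub] at this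
      have := mul_le_mul_of_nonneg_left this (sq_nonneg L)
      linarith
    have c := timeAvg_mono (τ := τ) b
    rw [timeAvg_mul_left, timeAvg_add, timeAvg_const hτ, timeAvg_mul_left] at c
    have e : driftSq τ x φ = timeAvg τ fun t => ∑ i, ‖φ t i - x i‖ ^ 2 := rfl
    rw [← e] at c
    linarith
  have hcoup : N * inner ℝ u (meanCoupling G ρ τ x φ)
      ≤ 1 / 8 * (N * ‖u‖ ^ 2) + 2 * ((ρ * d) ^ 2 * driftSq τ x φ) := by
    have b1 := mul_le_mul_of_nonneg_left (inner_le_young u (meanCoupling G ρ τ x φ)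
      (t := 1 / 8) (s := 2) (by norm_num) (by norm_num)) hN0
    have b2 := mul_norm_meanCoupling_sq_le (x := x) (φ := φ) hN hρ hτ hd
    linarith
  rw [hinner, hgrad] at hdesc
  have k1 := mul_le_mul_of_nonneg_left hcoup hpos.le
  have k2 := mul_le_mul_of_nonneg_left hdev hpos.le
  have k3 := mul_le_mul_of_nonneg_left hsq hL.le
  -- Lowering h² to h is affordable because the drift is itself of second order or is paid for by
  -- the displacement.
  have k4 : L * (3 * h ^ 2 * ((ρ * d) ^ 2 * driftSq τ x φ))
      ≤ L * (3 * h * ((ρ * d) ^ 2 * driftSq τ x φ)) := by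
    have : h ^ 2 ≤ h := by nlinarith
    have := driftSq_nonneg τ x φ
    gcongr
  linarith

end RoundEnergy

/-! ### Choice of weights and the Lyapunov inequality -/

section Lyapunov

variable {N n : ℕ} {G : SimpleGraph (Fin N)} [DecidableRel G.Adj] {L ρ γ lam : ℝ} {d τ : ℕ}
  {g : Fin N → Vec n → Vec n} {x Z : Fin N → Vec n} {ξ φ : ℕ → Fin N → Vec n}

/-- The weight of the consensus energy in the Lyapunov function. -/
noncomputable def energyWeight (L ℓ : ℝ) : ℝ := 16 * L ^ 2 / ℓ + 1

/-- The weight of the local drift in the error terms of one round. -/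
noncomputable def driftWeight (L ℓ κ : ℝ) : ℝ :=
  L ^ 2 + 2 * κ ^ 2 + 3 * L * κ ^ 2
    + energyWeight L ℓ * (16 * (L + κ) ^ 2 / ℓ + 195 * L ^ 2 * κ ^ 2 / ℓ ^ 2)

/-- The weight of the gradient noise in the error terms of one round. -/
noncomputable def noiseWeight (L ℓ : ℝ) : ℝ :=
  3 * L + energyWeight L ℓ * (5 + 195 * L ^ 2 / ℓ ^ 2) + 2

/-- The conditions on the effective step size `h = γ τ`. -/
structure IsSmallStep (L ℓ κ h : ℝ) : Prop where
  pos : 0 < h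
  coupling : 4 * h * κ ≤ 1
  gap : 80 * L ^ 2 * h ≤ ℓ
  lipschitz : 6 * h * (L + κ) ≤ 1
  le_one : h ≤ 1 / 8
  drift : 288 * driftWeight L ℓ κ * h ≤ 1
  grad : (3 * L + energyWeight L ℓ * (195 * L ^ 2 / ℓ ^ 2)) * h ≤ 1 / 4

/-- After rescaling, every condition reads `a * h ≤ 1` with a constant `a`; `c` is the sum of all
these constants. -/
theorem exists_isSmallStep {L ℓ κ : ℝ} (hL : 0 < L) (hℓ : 0 < ℓ) (hκ : 0 ≤ κ) :
    ∃ h₀ : ℝ, 0 < h₀ ∧ ∀ h, 0 < h → h < h₀ → IsSmallStep L ℓ κ h := by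
  have hA : 0 < energyWeight L ℓ := by unfold energyWeight; positivity
  have hD : 0 < driftWeight L ℓ κ := by unfold driftWeight; positivity
  set c := 4 * κ + 80 * L ^ 2 / ℓ + 6 * (L + κ) + 8 + 288 * driftWeight L ℓ κ
    + 4 * (3 * L + energyWeight L ℓ * (195 * L ^ 2 / ℓ ^ 2)) with hc
  have p1 : 0 ≤ 4 * κ := by positivity
  have p2 : 0 < 80 * L ^ 2 / ℓ := by positivity
  have p3 : 0 < 6 * (L + κ) := by positivity
  have p4 : 0 < 288 * driftWeight L ℓ κ := by positivity
  have p5 : 0 < 4 * (3 * L + energyWeight L ℓ * (195 * L ^ 2 / ℓ ^ 2)) := by positivity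
  have hcpos : 0 < c := by linarith
  refine ⟨1 / c, by positivity, fun h hh hlt => ?_⟩
  have key : ∀ a, a ≤ c → a * h ≤ 1 := fun a ha => by
    have := (lt_div_iff₀ hcpos).mp hlt
    have := mul_le_mul_of_nonneg_right ha hh.le
    linarith
  refine ⟨hh, ?_, ?_, ?_, ?_, ?_, ?_⟩
  · linarith [key (4 * κ) (by linarith)]
  · have := mul_le_mul_of_nonneg_right (key (80 * L ^ 2 / ℓ) (by linarith)) hℓ.le
    rw [one_mul] at this
    refine le_trans (le_of_eq ?_) this
    field_simp
  · linarith [key (6 * (L + κ)) (by linarith)]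
  · linarith [key 8 (by linarith)]
  · linarith [key (288 * driftWeight L ℓ κ) (by linarith)]
  · linarith [key (4 * (3 * L + energyWeight L ℓ * (195 * L ^ 2 / ℓ ^ 2))) (by linarith)]

set_option maxHeartbeats 1000000 in
/-- Decrease of the Lyapunov function in one round. -/
theorem IsRound.lyapunov_le (hr : IsRound G ρ γ g x Z ξ φ) (hG : G.Connected) (hL : 0 < L)
    (hρ : 0 < ρ) (hlam : 0 < lam) (hγ : 0 < γ) (hτ : 1 ≤ τ) (hd : G.maxDegree ≤ d)
    (hgap : ∀ l, lapEig G l ≠ 0 → lam ≤ lapEig G l) (hg : IsMonoLipschitz L g)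
    {F : Vec n → ℝ}
    (hF : ∀ u v, F v ≤ F u + inner ℝ (meanField g u) (v - u) + L * ‖v - u‖ ^ 2)
    (hs : IsSmallStep L (ρ * lam) (ρ * d) (γ * τ))
    (ω ω' : Fin N → Vec n) (hω : ω' = ω - (ρ / 2) • lapOp G (φ τ)) :
    N * F (mean (φ τ)) + energyWeight L (ρ * lam) * energy G ρ (γ * τ) g (φ τ) ω'
      ≤ N * F (mean x) + energyWeight L (ρ * lam) * energy G ρ (γ * τ) g x ω
      - (γ * τ) / 8 * (N * (‖meanField g (mean x)‖ ^ 2 + gradSq τ g φ))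
      - ∑ i, inner ℝ (meanField g (mean x) + energyWeight L (ρ * lam) • (x i - mean x))
          (roundNoise γ τ ξ i)
      + noiseWeight L (ρ * lam) * ((γ * τ) ^ 2 * noiseSq τ ξ)
      + 16 * energyWeight L (ρ * lam) / (ρ * lam) * ((γ * τ)
          * perpSq G (auxResidual G ρ x Z ω)) := by
  have hN : 0 < N := Fin.pos_iff_nonempty.mpr hG.nonempty
  have hN' : (N : ℝ) ≠ 0 := by positivity
  have hE := hr.energy_le hG hρ hlam hγ hτ hd hgap hg (by linarith [hs.coupling])
    (by linarith [hs.gap]) ω ω' hω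
  have hSd := hr.driftSq_le hG hL hρ hγ hτ hd hg hs.lipschitz
  have hC := hr.cost_le hG hL hρ hγ hτ hd hg hF (by linarith [hs.le_one])
  have hM := hr.mean_displacement_sq_le hG hρ hτ hd
  have hnoise : ∑ i, inner ℝ (meanField g (mean x) + energyWeight L (ρ * lam) • (x i - mean x))
      (roundNoise γ τ ξ i) = N * inner ℝ (meanField g (mean x)) (mean (roundNoise γ τ ξ))
        + energyWeight L (ρ * lam) * ∑ i, inner ℝ (x i - mean x) (roundNoise γ τ ξ i) := by
    simp only [inner_add_left, Finset.sum_add_distrib, inner_smul_left, ← Finset.mul_sum,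
      ← inner_sum]
    congr 1
    rw [show mean (roundNoise γ τ ξ) = (1 / (N : ℝ)) • ∑ i, roundNoise γ τ ξ i from rfl,
      inner_smul_right]
    field_simp
  rw [hnoise]
  set h := γ * τ with hh
  set ℓ := ρ * lam with hℓ
  set κ := ρ * d with hκ
  set A := energyWeight L ℓ with hA
  set a := perpSq G x
  set b := perpSq G (φ τ - x)
  set S := driftSq τ x φ
  set Ξ := noiseSq τ ξ
  set Rsq := perpSq G (auxResidual G ρ x Z ω)
  set M1 := ∑ i, inner ℝ (x i - mean x) (roundNoise γ τ ξ i)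
  set u := N * ‖meanField g (mean x)‖ ^ 2 with hu
  set Q := N * gradSq τ g φ with hQ
  set D := N * ‖mean (φ τ) - mean x‖ ^ 2
  have hℓpos : 0 < ℓ := by positivity
  have hκ0 : 0 ≤ κ := by positivity
  have hpos := hs.pos
  have ha0 : 0 ≤ a := perpSq_nonneg _ _
  have hb0 : 0 ≤ b := perpSq_nonneg _ _
  have hS0 : 0 ≤ S := driftSq_nonneg _ _ _
  have hΞ0 : 0 ≤ Ξ := noiseSq_nonneg _ _
  have hu0 : 0 ≤ u := by positivity
  have hQ0 : 0 ≤ Q := mul_nonneg (by positivity) (timeAvg_nonneg fun _ => by positivity)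
  have hA1 : 1 ≤ A := by
    have : 0 ≤ 16 * L ^ 2 / ℓ := by positivity
    simp only [hA, energyWeight]; linarith
  -- The energy weight is made for this identity: the damping Aℓ/8 contains 2L², one L² for the
  -- consensus error in the cost descent and one for that in the drift bound. The summand 1 in the
  -- weight ensures `1 ≤ A`.
  have hAℓ : A * ℓ = 16 * L ^ 2 + ℓ := by
    simp only [hA, energyWeight]; field_simp
  set β := driftWeight L ℓ κ with hβ
  have hβpos : 0 < β := by rw [hβ, driftWeight]; positivity
  have hβe : β = L ^ 2 + 2 * κ ^ 2 + 3 * L * κ ^ 2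
    + A * (16 * (L + κ) ^ 2 / ℓ + 195 * L ^ 2 * κ ^ 2 / ℓ ^ 2) := rfl
  have hne : noiseWeight L ℓ = 3 * L + A * (5 + 195 * L ^ 2 / ℓ ^ 2) + 2 := rfl
  have hh2 : h ^ 2 ≤ h := by nlinarith [hs.le_one]
  have hβh : h * β ≤ 1 / 288 := by linarith [hs.drift]
  set c2 := L ^ 2 / ℓ ^ 2 with hc2
  have hc20 : 0 ≤ c2 := by positivity
  -- The shift `η` is replaced by the bound on the displacement of the mean; 195 is 65 · 3.
  have hE2 : energy G ρ h g (φ τ) ω' ≤ energy G ρ h g x ω - h * ℓ / 8 * a - 1 / 8 * b - M1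
      + h * ((16 * (L + κ) ^ 2 / ℓ + 195 * L ^ 2 * κ ^ 2 / ℓ ^ 2) * S)
      + 16 / ℓ * (h * Rsq) + (5 + 195 * c2) * (h ^ 2 * Ξ) + 195 * c2 * (h ^ 2 * Q) := by
    have e1 : 65 / ℓ ^ 2 * (L ^ 2 * D) = 65 * c2 * D := by rw [hc2]; ring
    have e2 := mul_le_mul_of_nonneg_left hM (show 0 ≤ 65 * c2 by positivity)
    have e3 : h ^ 2 * (195 * c2 * (κ ^ 2 * S)) ≤ h * (195 * c2 * (κ ^ 2 * S)) := by gcongr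
    have e4 : 195 * L ^ 2 * κ ^ 2 / ℓ ^ 2 = 195 * c2 * κ ^ 2 := by rw [hc2]; ring
    rw [e4]
    have e5 : 16 * h / ℓ * ((L + κ) ^ 2 * S + Rsq)
        = h * (16 * (L + κ) ^ 2 / ℓ * S) + 16 / ℓ * (h * Rsq) := by ring
    rw [e1, e5] at hE
    linarith
  have hAE := mul_le_mul_of_nonneg_left hE2 (show 0 ≤ A by linarith)
  -- Since 36/288 = 1/8, the drift uses up no more displacement than the energy estimate releases,
  -- thanks to `1 ≤ A`.
  have hSb : h * (β * S) ≤ A * (1 / 8 * b) + 2 * (h ^ 2 * Ξ) + h / 8 * u + h * (L ^ 2 * a) := by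
    have f1 := mul_le_mul_of_nonneg_left hSd (show 0 ≤ h * β by positivity)
    have f2 := mul_le_mul_of_nonneg_right hβh (show 0 ≤ 36 * b + 48 * (h ^ 2 * Ξ)
      + 24 * h ^ 2 * (u + L ^ 2 * a) by positivity)
    have f3 : 1 / 8 * b ≤ A * (1 / 8 * b) := by nlinarith
    have f4 := mul_le_mul_of_nonneg_right hh2 (show 0 ≤ u + L ^ 2 * a by positivity)
    have f5 : 0 ≤ h ^ 2 * Ξ := by positivity
    have f6 : 0 ≤ h * u := by positivity
    have f7 : 0 ≤ h * (L ^ 2 * a) := by positivity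
    linarith
  -- Costs half of the term (h/2)Q gained in the cost descent.
  have hQs : (3 * L + A * (195 * c2)) * (h ^ 2 * Q) ≤ h / 4 * Q := by
    have : (3 * L + A * (195 * c2)) * h ≤ 1 / 4 := by
      have := hs.grad
      rw [mul_div_assoc] at this
      exact this
    have := mul_le_mul_of_nonneg_right this (show 0 ≤ h * Q by positivity)
    linarith
  have haA : A * (h * ℓ / 8 * a) = h * (2 * (L ^ 2 * a)) + h * ℓ / 8 * a := by
    linear_combination (h / 8 * a) * hAℓ
  have z1 : 0 ≤ h * ℓ / 8 * a := by positivity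
  have z2 : 0 ≤ h * u := by positivity
  have z3 : 0 ≤ h * Q := by positivity
  have z4 : h * (β * S) = h * ((L ^ 2 + 2 * κ ^ 2 + 3 * L * κ ^ 2) * S)
      + A * (h * ((16 * (L + κ) ^ 2 / ℓ + 195 * L ^ 2 * κ ^ 2 / ℓ ^ 2) * S)) := by
    rw [hβe]; ring
  have z5 : noiseWeight L ℓ * (h ^ 2 * Ξ) = 3 * L * (h ^ 2 * Ξ)
      + A * ((5 + 195 * c2) * (h ^ 2 * Ξ)) + 2 * (h ^ 2 * Ξ) := by rw [hne, hc2]; ring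
  have z6 : 16 * A / ℓ * (h * Rsq) = A * (16 / ℓ * (h * Rsq)) := by ring
  have z7 : N * (‖meanField g (mean x)‖ ^ 2 + gradSq τ g φ) = u + Q := by
    rw [hu, hQ]; ring
  rw [z5, z6, z7]
  linarith

end Lyapunov

open MeasureTheory ProbabilityTheory

/-! ### Functions of finitely many draws from a finite set -/

section FiniteRandomness

variable {ι β Ω α : Type*}

/-- The random element `U` is a function of the family `B` restricted to `S`. -/
def IsDeterminedBy (B : ι → Ω → β) (S : Finset ι) (U : Ω → α) : Prop :=
  ∀ ω ω', (∀ s ∈ S, B s ω = B s ω') → U ω = U ω'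

/-- Values of the family that are actually attained are lifted to any preimage, the others get a
default. No measurability of `U` is needed. -/
theorem IsDeterminedBy.exists_eq_comp [Nonempty Ω] {B : ι → Ω → β} {S : Finset ι} {U : Ω → α}
    (hU : IsDeterminedBy B S U) : ∃ u : (S → β) → α, ∀ ω, U ω = u fun s => B s ω := by
  classical
  refine ⟨fun v => if hv : ∃ ω, (fun s : S => B s ω) = v then U hv.choose
    else U (Classical.arbitrary Ω), fun ω => ?_⟩
  have hv : ∃ ω', (fun s : S => B s ω') = fun s : S => B s ω := ⟨ω, rfl⟩
  simp only [dif_pos hv]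
  exact hU _ _ fun s hs => (congrFun hv.choose_spec ⟨s, hs⟩).symm

variable [MeasurableSpace Ω] {P : Measure Ω} [Finite β] [MeasurableSpace β] [DiscreteMeasurableSpace β]
  [IsProbabilityMeasure P] {B : ι → Ω → β} {S : Finset ι}

/-- `U` factors through the finite space `S → β`, on which every function is integrable. This makes
all integrability questions about the algorithm automatic. -/
theorem IsDeterminedBy.integrable {E : Type*} [NormedAddCommGroup E]
    (hB : ∀ i, Measurable (B i)) {U : Ω → E} (hU : IsDeterminedBy B S U) : Integrable U P := by
  have : Nonempty Ω := nonempty_of_isProbabilityMeasure P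
  obtain ⟨u, hu⟩ := hU.exists_eq_comp
  have hm : Measurable fun ω => fun s : S => B s ω := measurable_pi_lambda _ fun s => hB s
  have : IsProbabilityMeasure (P.map fun ω => fun s : S => B s ω) :=
    Measure.isProbabilityMeasure_map hm.aemeasurable
  have h : Integrable u (P.map fun ω => fun s : S => B s ω) := Integrable.of_finite
  have h2 := h.comp_measurable hm
  exact h2.congr (Filter.Eventually.of_forall fun ω => (hu ω).symm)

/-- Averaging over a draw that is independent of the past. -/
theorem integral_eq_integral_integral (hB : ∀ i, Measurable (B i)) (hind : iIndepFun B P) {j : ι}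
    (hj : j ∉ S) {U : Ω → α} (hU : IsDeterminedBy B S U) (Ψ : α → β → ℝ) :
    ∫ ω, Ψ (U ω) (B j ω) ∂P = ∫ ω, ∫ ω', Ψ (U ω) (B j ω') ∂P ∂P := by
  have : Nonempty Ω := nonempty_of_isProbabilityMeasure P
  obtain ⟨u, hu⟩ := hU.exists_eq_comp
  have hm : Measurable fun ω => fun s : S => B s ω := measurable_pi_lambda _ fun s => hB s
  -- Joint independence makes the whole block of draws in `S` independent of draw `j`; the joint law
  -- is then a product and Fubini applies.
  have h1 : IndepFun (fun ω (s : S) => B s ω) (B j) P := by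
    have h := hind.indepFun_finset S {j} (by simpa using hj) hB
    exact h.comp measurable_id (measurable_pi_apply (⟨j, by simp⟩ : ({j} : Finset ι)))
  have hmap := (indepFun_iff_map_prod_eq_prod_map_map hm.aemeasurable (hB j).aemeasurable).mp h1
  have := Measure.isProbabilityMeasure_map (μ := P) hm.aemeasurable
  have := Measure.isProbabilityMeasure_map (μ := P) (hB j).aemeasurable
  calc ∫ ω, Ψ (U ω) (B j ω) ∂P
      = ∫ p, Ψ (u p.1) p.2 ∂(P.map fun ω => ((fun s : S => B s ω), B j ω)) := by
        rw [integral_map (hm.prodMk (hB j)).aemeasurable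
          (measurable_of_countable _).aestronglyMeasurable]
        simp only [hu]
    _ = ∫ v, ∫ b, Ψ (u v) b ∂(P.map (B j)) ∂(P.map fun ω (s : S) => B s ω) := by
        rw [hmap, integral_prod _ Integrable.of_finite]
    _ = ∫ ω, ∫ ω', Ψ (U ω) (B j ω') ∂P ∂P := by
        rw [integral_map hm.aemeasurable (measurable_of_countable _).aestronglyMeasurable]
        refine integral_congr_ae (Filter.Eventually.of_forall fun ω => ?_)
        simp only
        rw [integral_map (hB j).aemeasurable (measurable_of_countable _).aestronglyMeasurable]
        simp only [hu]

end FiniteRandomness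

/-! ### Trajectories of the algorithm and their dual variable -/

section Trajectories

variable {N n : ℕ} {m : Fin N → ℕ} {f : (i : Fin N) → Fin (m i) → Vec n → ℝ}
  {G : SimpleGraph (Fin N)} [DecidableRel G.Adj] {ρ γ : ℝ} {τ : ℕ}

theorem localIter_congr {b b' : ℕ → (i : Fin N) → Finset (Fin (m i))} {x : Fin N → Vec n}
    {z : Fin N → Fin N → Vec n} {t : ℕ} (h : ∀ s < t, b s = b' s) :
    localIter f G ρ γ b x z t = localIter f G ρ γ b' x z t := by
  induction t with
  | zero => rfl
  | succ t ih =>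
    funext i
    simp only [localIter, ih fun s hs => h s (hs.trans t.lt_succ_self), h t t.lt_succ_self]

/-- The restriction `s < τ` matters: the state depends on finitely many draws only. -/
theorem state_congr {b b' : ℕ → ℕ → (i : Fin N) → Finset (Fin (m i))} {x₀ : Fin N → Vec n}
    {z₀ : Fin N → Fin N → Vec n} {k : ℕ} (h : ∀ j < k, ∀ s < τ, b j s = b' j s) :
    state f G ρ γ τ b x₀ z₀ k = state f G ρ γ τ b' x₀ z₀ k := by
  induction k with
  | zero => rfl
  | succ k ih =>
    have h1 := ih fun j hj => h j (hj.trans k.lt_succ_self)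
    simp only [state, h1]
    rw [localIter_congr (h k k.lt_succ_self)]

/-- The sum over the neighbours of the auxiliary variables held by each agent. -/
noncomputable def auxSum (G : SimpleGraph (Fin N)) [DecidableRel G.Adj]
    (z : Fin N → Fin N → Vec n) : Fin N → Vec n :=
  fun i => ∑ j ∈ G.neighborFinset i, z i j

/-- The dual variable: the antisymmetric part of the auxiliary variables, summed over neighbours. -/
noncomputable def dualVar (G : SimpleGraph (Fin N)) [DecidableRel G.Adj]
    (z : Fin N → Fin N → Vec n) : Fin N → Vec n :=
  fun i => (1 / 2 : ℝ) • (∑ j ∈ G.neighborFinset i, z i j - ∑ j ∈ G.neighborFinset i, z j i)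

theorem auxSum_auxUpdate (x : Fin N → Vec n) (z : Fin N → Fin N → Vec n) (i : Fin N) :
    auxSum G (auxUpdate ρ x z) i = dualVar G z i + ρ • ∑ j ∈ G.neighborFinset i, x j := by
  simp only [auxSum, auxUpdate, dualVar, ← Finset.sum_sub_distrib, Finset.smul_sum,
    ← Finset.sum_add_distrib]
  refine Finset.sum_congr rfl fun j _ => ?_
  module

/-- The antisymmetric part of z changes on the edge ij by (ρ/2)(x_j - x_i); summed over neighbours
this is a Laplacian step, evaluated at the new x. -/
theorem dualVar_auxUpdate (x : Fin N → Vec n) (z : Fin N → Fin N → Vec n) :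
    dualVar G (auxUpdate ρ x z) = dualVar G z - (ρ / 2) • lapOp G x := by
  funext i
  have hdeg : (G.degree i : ℝ) • x i = ∑ j ∈ G.neighborFinset i, x i := by
    simp [Nat.cast_smul_eq_nsmul]
  simp only [dualVar, auxUpdate, lapOp, Pi.sub_apply, Pi.smul_apply, hdeg,
    ← Finset.sum_sub_distrib, Finset.smul_sum]
  refine Finset.sum_congr rfl fun j _ => ?_
  module

/-- One communication ties the symmetric part of the auxiliary variables to x, so the residual can
be nonzero only in the first round. -/
theorem auxResidual_auxUpdate (x : Fin N → Vec n) (z : Fin N → Fin N → Vec n) :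
    auxResidual G ρ x (auxSum G (auxUpdate ρ x z)) (dualVar G (auxUpdate ρ x z)) = 0 := by
  funext i
  simp only [auxResidual, auxSum_auxUpdate, dualVar_auxUpdate, lapOp, Pi.sub_apply, Pi.smul_apply,
    Pi.zero_apply]
  module

theorem sum_dualVar (z : Fin N → Fin N → Vec n) : ∑ i, dualVar G z i = 0 := by
  simp only [dualVar, ← Finset.smul_sum, Finset.sum_sub_distrib]
  rw [sum_neighborFinset_comm G z, sub_self, smul_zero]

/-- The balance condition holds after any communication, whatever z was before; hence it has to be
assumed only at time zero. -/
theorem sum_auxSum_auxUpdate (x : Fin N → Vec n) (z : Fin N → Fin N → Vec n) :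
    ∑ i, auxSum G (auxUpdate ρ x z) i = ρ • ∑ i, (G.degree i : ℝ) • x i := by
  simp only [auxSum_auxUpdate, Finset.sum_add_distrib, sum_dualVar, zero_add, ← Finset.smul_sum]
  rw [sum_neighborFinset_comm G fun _ j => x j]
  simp [Nat.cast_smul_eq_nsmul]

theorem sum_auxSum_state {b : ℕ → ℕ → (i : Fin N) → Finset (Fin (m i))} {x₀ : Fin N → Vec n}
    {z₀ : Fin N → Fin N → Vec n}
    (h₀ : ∑ i, ∑ j ∈ G.neighborFinset i, z₀ i j = ρ • ∑ i, (G.degree i : ℝ) • x₀ i) (k : ℕ) :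
    ∑ i, auxSum G (state f G ρ γ τ b x₀ z₀ k).2 i
      = ρ • ∑ i, (G.degree i : ℝ) • (state f G ρ γ τ b x₀ z₀ k).1 i := by
  cases k with
  | zero => exact h₀
  | succ k => exact sum_auxSum_auxUpdate _ _

/-- The error of the gradient estimators along the trajectory. -/
noncomputable def gradNoise (f : (i : Fin N) → Fin (m i) → Vec n → ℝ) (G : SimpleGraph (Fin N))
    [DecidableRel G.Adj] (ρ γ : ℝ) (τ : ℕ) (b : ℕ → ℕ → (i : Fin N) → Finset (Fin (m i)))
    (x₀ : Fin N → Vec n) (z₀ : Fin N → Fin N → Vec n) (k t : ℕ) : Fin N → Vec n :=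
  fun i => batchGrad f i (b k t i) (phi f G ρ γ τ b x₀ z₀ k t i)
    - gradient (localCost f i) (phi f G ρ γ τ b x₀ z₀ k t i)

theorem isRound_phi {b : ℕ → ℕ → (i : Fin N) → Finset (Fin (m i))} {x₀ : Fin N → Vec n}
    {z₀ : Fin N → Fin N → Vec n}
    (h₀ : ∑ i, ∑ j ∈ G.neighborFinset i, z₀ i j = ρ • ∑ i, (G.degree i : ℝ) • x₀ i) (k : ℕ) :
    IsRound G ρ γ (fun i => gradient (localCost f i)) (state f G ρ γ τ b x₀ z₀ k).1
      (auxSum G (state f G ρ γ τ b x₀ z₀ k).2) (gradNoise f G ρ γ τ b x₀ z₀ k)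
      (phi f G ρ γ τ b x₀ z₀ k) where
  init := rfl
  step t i := by
    simp only [gradNoise, add_sub_cancel]
    rfl
  balance := sum_auxSum_state h₀ k

end Trajectories

/-! ### Convexity and smoothness of the costs -/

section Calculus

theorem convex_first_order {E : Type*} [NormedAddCommGroup E] [InnerProductSpace ℝ E]
    [CompleteSpace E] {F : E → ℝ} (hc : ConvexOn ℝ Set.univ F) (hF : Differentiable ℝ F) (x y : E) :
    F x + inner ℝ (gradient F x) (y - x) ≤ F y := by
  have h1 : ConvexOn ℝ Set.univ (F ∘ AffineMap.lineMap (k := ℝ) x y) := by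
    simpa using hc.comp_affineMap (AffineMap.lineMap (k := ℝ) x y)
  have h2 : HasDerivAt (F ∘ AffineMap.lineMap (k := ℝ) x y)
      (fderiv ℝ F x (y - x)) 0 := by
    have h := (hF (AffineMap.lineMap (k := ℝ) x y 0)).hasFDerivAt
    simpa using h.comp_hasDerivAt (0 : ℝ) AffineMap.hasDerivAt_lineMap
  have h3 := h1.le_slope_of_hasDerivAt (Set.mem_univ 0) (Set.mem_univ 1) zero_lt_one h2
  rw [slope_def_field] at h3
  simp only [Function.comp_apply, AffineMap.lineMap_apply_one, AffineMap.lineMap_apply_zero,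
    sub_zero, div_one] at h3
  rw [inner_gradient_left]
  linarith

theorem gradient_eq_zero_iff_forall_le {E : Type*} [NormedAddCommGroup E] [InnerProductSpace ℝ E]
    [CompleteSpace E] {F : E → ℝ} (hc : ConvexOn ℝ Set.univ F) (hF : Differentiable ℝ F) (x : E) :
    gradient F x = 0 ↔ ∀ y, F x ≤ F y := by
  constructor
  · intro h y
    simpa [h] using convex_first_order hc hF x y
  · intro h
    have : IsLocalMin F x := Filter.Eventually.of_forall h
    simp [gradient, this.fderiv_eq_zero]

variable {N n : ℕ} {m : Fin N → ℕ} {f : (i : Fin N) → Fin (m i) → Vec n → ℝ} {L : ℝ}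

theorem differentiable_localCost (hf : IsSmoothProblem f L) (i : Fin N) :
    Differentiable ℝ (localCost f i) := by
  unfold localCost
  exact (Differentiable.fun_sum fun h _ => hf.1 i h).const_mul _

theorem differentiable_globalCost (hf : IsSmoothProblem f L) :
    Differentiable ℝ (globalCost f) := by
  unfold globalCost
  exact (Differentiable.fun_sum fun i _ => differentiable_localCost hf i).const_mul _

theorem convexOn_globalCost (hc : ∀ i, ConvexOn ℝ Set.univ (localCost f i)) :
    ConvexOn ℝ Set.univ (globalCost f) := by
  have h : ∀ s : Finset (Fin N), ConvexOn ℝ Set.univ fun x => ∑ i ∈ s, localCost f i x := by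
    intro s
    induction s using Finset.cons_induction with
    | empty => simpa using convexOn_const (0 : ℝ) convex_univ
    | cons i s hi ih =>
      simp only [Finset.sum_cons]
      exact (hc i).add ih
  exact (h Finset.univ).smul (by positivity : (0 : ℝ) ≤ 1 / (N : ℝ))

theorem gradient_globalCost (hf : IsSmoothProblem f L) (y : Vec n) :
    gradient (globalCost f) y = meanField (fun i => gradient (localCost f i)) y := by
  refine ext_inner_right ℝ fun v => ?_
  rw [inner_gradient_left]
  have h : HasFDerivAt (globalCost f)
      ((1 / (N : ℝ)) • ∑ i, fderiv ℝ (localCost f i) y) y := by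
    unfold globalCost
    exact (HasFDerivAt.fun_sum fun i _ =>
      (differentiable_localCost hf i y).hasFDerivAt).const_mul _
  rw [h.fderiv]
  simp [meanField, mean, inner_smul_left, sum_inner, inner_gradient_left]

theorem isMonoLipschitz_gradient (hf : IsSmoothProblem f L)
    (hc : ∀ i, ConvexOn ℝ Set.univ (localCost f i)) :
    IsMonoLipschitz L fun i => gradient (localCost f i) where
  lip := hf.2
  mono i x y := by
    have h1 := convex_first_order (hc i) (differentiable_localCost hf i) x y
    have h2 := convex_first_order (hc i) (differentiable_localCost hf i) y x
    rw [← neg_sub x y, inner_neg_right] at h1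
    rw [real_inner_comm, inner_sub_left]
    linarith

/-- The first-order convexity inequality at `v`, with the gradient moved back to `u` by the
Lipschitz bound, replaces integration along the segment. This gives the constant L in place of L/2.
-/
theorem globalCost_le (hN : 0 < N) (hf : IsSmoothProblem f L)
    (hc : ∀ i, ConvexOn ℝ Set.univ (localCost f i)) (u v : Vec n) :
    globalCost f v ≤ globalCost f u
      + inner ℝ (meanField (fun i => gradient (localCost f i)) u) (v - u) + L * ‖v - u‖ ^ 2 := by
  have hN' : (N : ℝ) ≠ 0 := by positivity
  have h : ∀ i, localCost f i v ≤ localCost f i u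
      + inner ℝ (gradient (localCost f i) u) (v - u) + L * ‖v - u‖ ^ 2 := by
    intro i
    have h1 := convex_first_order (hc i) (differentiable_localCost hf i) v u
    have h2 := real_inner_le_norm (gradient (localCost f i) v - gradient (localCost f i) u) (v - u)
    have h3 := mul_le_mul_of_nonneg_right (hf.2 i v u) (norm_nonneg (v - u))
    rw [← neg_sub v u, inner_neg_right] at h1
    rw [inner_sub_left] at h2
    linarith
  have h2 := mul_le_mul_of_nonneg_left (Finset.sum_le_sum fun i (_ : i ∈ Finset.univ) => h i)
    (show 0 ≤ 1 / (N : ℝ) by positivity)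
  refine h2.trans_eq ?_
  simp only [globalCost, meanField, mean, Finset.sum_add_distrib, inner_smul_left, sum_inner,
    Finset.sum_const, Finset.card_univ, Fintype.card_fin, nsmul_eq_mul, mul_add]
  congr 1
  field_simp

theorem isConsensusOptimum_iff (hN : 0 < N) (xs : Vec n) :
    IsConsensusOptimum f xs ↔ ∀ y, globalCost f xs ≤ globalCost f y := by
  constructor
  · intro h y
    exact h (fun _ => y) fun _ _ => rfl
  · intro h x hx
    have : ∀ i, x i = x ⟨0, hN⟩ := fun i => hx _ _
    simp only [this]
    exact h _

end Calculus

/-! ### The initial energy in terms of the mode matrix -/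

section InitialBound

/-- The numbers `d₁₂`, `d₁₃` of the mode matrix have squared modulus `2 γ τ / (ρ μ)`. -/
theorem norm_neg_add_mul_I_sq {h c t : ℝ} (ht : t ^ 2 = 2 * h / c - h ^ 2) :
    ‖((-h : ℝ) : ℂ) + (t : ℝ) * Complex.I‖ ^ 2 = 2 * h / c := by
  rw [Complex.sq_norm, Complex.normSq_add_mul_I, ht]
  ring

/-- The entries of the first row have squared modulus at most 2h/c, while those of the other rows
stay bounded. Hence only `X` gains a factor h, as the initial energy requires. -/
theorem mode_matrix_norm_bounds {h c t : ℝ} (hh : 0 < h) (hc : 0 < c) (hhc : h * c ≤ 1 / 2)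
    (ht : t ^ 2 = 2 * h / c - h ^ 2) {w : Fin 3 → ℂ} {X Y Y' : ℝ}
    (hV : !![-(h : ℂ), ((-h : ℝ) : ℂ) + (t : ℝ) * Complex.I,
          ((-h : ℝ) : ℂ) + (-t : ℝ) * Complex.I;
        1, -(c : ℂ) * (((-h : ℝ) : ℂ) + (t : ℝ) * Complex.I) - 1,
          -(c : ℂ) * (((-h : ℝ) : ℂ) + (-t : ℝ) * Complex.I) - 1;
        1, 1, 1].mulVec w = ![(X : ℂ), (Y : ℂ), (Y' : ℂ)]) :
    X ^ 2 ≤ 6 * h / c * ∑ a, ‖w a‖ ^ 2 ∧ Y ^ 2 ≤ 18 * ∑ a, ‖w a‖ ^ 2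
      ∧ Y' ^ 2 ≤ 3 * ∑ a, ‖w a‖ ^ 2 := by
  set p : ℂ := ((-h : ℝ) : ℂ) + (t : ℝ) * Complex.I with hp
  set p' : ℂ := ((-h : ℝ) : ℂ) + (-t : ℝ) * Complex.I with hp'
  have np : ‖p‖ ^ 2 = 2 * h / c := norm_neg_add_mul_I_sq ht
  have np' : ‖p'‖ ^ 2 = 2 * h / c := norm_neg_add_mul_I_sq (by rw [neg_sq, ht])
  have hh2 : h ^ 2 ≤ 2 * h / c := by
    rw [le_div_iff₀ hc]; nlinarith
  have hq : ∀ z : ℂ, ‖z‖ ^ 2 = 2 * h / c → ‖-(c : ℂ) * z - 1‖ ^ 2 ≤ 6 := by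
    intro z hz
    refine (norm_sub_sq_le_two _ _).trans ?_
    rw [norm_mul, mul_pow, hz]
    have : c ^ 2 * (2 * h / c) = 2 * (h * c) := by field_simp
    simp only [norm_neg, Complex.norm_real, Real.norm_eq_abs, sq_abs, this, norm_one]
    linarith
  have h0 := congrFun hV 0
  have h1 := congrFun hV 1
  have h2 := congrFun hV 2
  simp only [Matrix.mulVec, dotProduct, Fin.sum_univ_three, Matrix.of_apply, Matrix.cons_val_zero,
    Matrix.cons_val_one, Matrix.cons_val] at h0 h1 h2
  rw [Fin.sum_univ_three]
  have nr : ∀ r : ℝ, r ^ 2 = ‖(r : ℂ)‖ ^ 2 := fun r => by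
    rw [Complex.norm_real, Real.norm_eq_abs, sq_abs]
  refine ⟨?_, ?_, ?_⟩
  · rw [nr, ← h0]
    refine (norm_add_sq_le_three _ _ _).trans ?_
    rw [norm_mul, norm_mul, norm_mul, mul_pow, mul_pow, mul_pow, np, np', norm_neg, ← nr]
    have := mul_le_mul_of_nonneg_right hh2 (sq_nonneg ‖w 0‖)
    have e : 6 * h / c = 3 * (2 * h / c) := by ring
    rw [e]
    linarith
  · rw [nr, ← h1]
    refine (norm_add_sq_le_three _ _ _).trans ?_
    rw [norm_mul, norm_mul, norm_mul, mul_pow, mul_pow, mul_pow, norm_one]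
    have b1 := mul_le_mul_of_nonneg_right (hq p np) (sq_nonneg ‖w 1‖)
    have b2 := mul_le_mul_of_nonneg_right (hq p' np') (sq_nonneg ‖w 2‖)
    have b3 := sq_nonneg ‖w 0‖
    linarith
  · rw [nr, ← h2]
    refine (norm_add_sq_le_three _ _ _).trans ?_
    simp only [one_mul]
    exact le_rfl

/-- Bounds for the components of a mode in terms of its coordinates in the columns of the mode
matrix. -/
theorem modeMatrix_inv_bounds {ρ γ lam : ℝ} {τ : ℕ} (hρ : 0 < ρ) (hlam : 0 < lam)
    (hh : 0 < γ * τ) (hhc : γ * τ * (ρ * lam) ≤ 1 / 2) (X Y Y' : ℝ) :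
    X ^ 2 ≤ 6 * (γ * τ) / (ρ * lam) * ∑ a, ‖((modeMatrix ρ γ τ (-lam))⁻¹.mulVec
        ![(X : ℂ), (Y : ℂ), (Y' : ℂ)]) a‖ ^ 2
      ∧ Y ^ 2 ≤ 18 * ∑ a, ‖((modeMatrix ρ γ τ (-lam))⁻¹.mulVec
        ![(X : ℂ), (Y : ℂ), (Y' : ℂ)]) a‖ ^ 2
      ∧ Y' ^ 2 ≤ 3 * ∑ a, ‖((modeMatrix ρ γ τ (-lam))⁻¹.mulVec
        ![(X : ℂ), (Y : ℂ), (Y' : ℂ)]) a‖ ^ 2 := by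
  set h := γ * τ with hhdef
  set c := ρ * lam with hcdef
  have hc : 0 < c := by positivity
  set D : ℝ := -(γ * τ * ρ * (-lam) * (γ * τ * ρ * (-lam) + 2)) with hD
  have hDe : D = h * c * (2 - h * c) := by rw [hD, hhdef, hcdef]; ring
  have hDpos : 0 < D := by
    rw [hDe]
    have : 0 < h * c := by positivity
    nlinarith
  -- The sign comes from the division by the negative number `-lam * ρ` in the mode matrix.
  set t : ℝ := -(Real.sqrt D / c) with ht
  have htsq : t ^ 2 = 2 * h / c - h ^ 2 := by
    rw [ht, neg_sq, div_pow, Real.sq_sqrt hDpos.le, hDe]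
    field_simp
  have htne : t ≠ 0 := by
    rw [ht]
    exact neg_ne_zero.mpr (div_pos (Real.sqrt_pos.mpr hDpos) hc).ne'
  have hcC : (c : ℂ) ≠ 0 := by exact_mod_cast hc.ne'
  have hρC : (ρ : ℂ) ≠ 0 := by exact_mod_cast hρ.ne'
  have hlC : (lam : ℂ) ≠ 0 := by exact_mod_cast hlam.ne'
  have hV : modeMatrix ρ γ τ (-lam) = !![-(h : ℂ), ((-h : ℝ) : ℂ) + (t : ℝ) * Complex.I,
          ((-h : ℝ) : ℂ) + (-t : ℝ) * Complex.I;
        1, -(c : ℂ) * (((-h : ℝ) : ℂ) + (t : ℝ) * Complex.I) - 1,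
          -(c : ℂ) * (((-h : ℝ) : ℂ) + (-t : ℝ) * Complex.I) - 1;
        1, 1, 1] := by
    have e1 : ((-h : ℝ) : ℂ) + (t : ℝ) * Complex.I
        = -(γ * τ : ℂ) + Complex.I * (Real.sqrt D : ℂ) / (((-lam : ℝ) : ℂ) * ρ) := by
      rw [ht, hhdef, hcdef]
      push_cast
      field_simp
    have e2 : ((-h : ℝ) : ℂ) + (-t : ℝ) * Complex.I
        = -(γ * τ : ℂ) - Complex.I * (Real.sqrt D : ℂ) / (((-lam : ℝ) : ℂ) * ρ) := by
      rw [ht, hhdef, hcdef]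
      push_cast
      field_simp
      ring
    have e3 : -(c : ℂ) = ((-lam : ℝ) : ℂ) * ρ := by rw [hcdef]; push_cast; ring
    have e4 : -(h : ℂ) = -(γ * τ : ℂ) := by rw [hhdef]; push_cast; ring
    rw [e1, e2, e3, e4]
    rfl
  -- The determinant is -2ti(2 - ch), nonzero because t ≠ 0 and ch < 2.
  have hdet : IsUnit (modeMatrix ρ γ τ (-lam)).det := by
    rw [isUnit_iff_ne_zero, hV, Matrix.det_fin_three]
    simp only [Matrix.of_apply, Matrix.cons_val_zero, Matrix.cons_val_one, Matrix.cons_val]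
    have e : -(2 * ((t : ℂ) * Complex.I) * (2 - c * h)) ≠ 0 := by
      have k1 : (t : ℂ) ≠ 0 := by exact_mod_cast htne
      have k2 : (2 - c * h : ℂ) ≠ 0 := by
        have : (2 - c * h : ℝ) ≠ 0 := ne_of_gt (by linarith [mul_comm c h])
        exact_mod_cast this
      have k3 := Complex.I_ne_zero
      exact neg_ne_zero.mpr (mul_ne_zero (mul_ne_zero two_ne_zero (mul_ne_zero k1 k3)) k2)
    convert e using 1
    push_cast
    ring
  refine mode_matrix_norm_bounds hh hc hhc htsq (w := (modeMatrix ρ γ τ (-lam))⁻¹.mulVec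
        ![(X : ℂ), (Y : ℂ), (Y' : ℂ)]) ?_
  rw [← hV, Matrix.mulVec_mulVec, Matrix.mul_nonsing_inv _ hdet, Matrix.one_mulVec]

variable {N n : ℕ} {m : Fin N → ℕ} {f : (i : Fin N) → Fin (m i) → Vec n → ℝ}
  {G : SimpleGraph (Fin N)} [DecidableRel G.Adj] {ρ γ lam : ℝ} {τ d : ℕ}
  {x : Fin N → Vec n} {z : Fin N → Fin N → Vec n}

theorem dualVar_sub_gradient :
    (fun i => dualVar G z i - gradient (localCost f i) (mean x))
      = (1 / 2 : ℝ) • (devY f G ρ x z - devYt f G ρ x z) := by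
  funext i
  simp only [dualVar, devY, devYt, Pi.smul_apply, Pi.sub_apply]
  module

/-- In the half sum of `devY` and `devYt` the gradients cancel, as the degree terms do in their half
difference; so these two vectors and x determine both the residual and W. -/
theorem auxResidual_eq :
    auxResidual G ρ x (auxSum G z) (dualVar G z)
      = (1 / 2 : ℝ) • (devY f G ρ x z + devYt f G ρ x z) + (ρ / 2) • lapOp G x := by
  funext i
  simp only [auxResidual, auxSum, dualVar, devY, devYt, Pi.smul_apply, Pi.add_apply]
  module

/-- The summand of `dhatSq` at the mode `l`. -/
noncomputable def dhatMode (f : (i : Fin N) → Fin (m i) → Vec n → ℝ) (G : SimpleGraph (Fin N))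
    [DecidableRel G.Adj] (ρ γ : ℝ) (τ : ℕ) (x : Fin N → Vec n) (z : Fin N → Fin N → Vec n)
    (l : Fin N) : ℝ :=
  ∑ c : Fin n, ∑ a : Fin 3, ‖((modeMatrix ρ γ τ (-lapEig G l))⁻¹.mulVec
        ![(modeComponent G l x c : ℂ),
          (modeComponent G l (devY f G ρ x z) c : ℂ),
          (modeComponent G l (devYt f G ρ x z) c : ℂ)]) a‖ ^ 2

theorem dhatSq_eq : dhatSq f G ρ γ τ x z = ∑ l ∈ modes G, dhatMode f G ρ γ τ x z l := by
  rw [dhatSq, modes, Finset.sum_filter]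
  refine Finset.sum_congr rfl fun l _ => ?_
  by_cases h : lapEig G l = 0 <;> simp [h, dhatMode]

theorem dhatMode_nonneg (l : Fin N) : 0 ≤ dhatMode f G ρ γ τ x z l := by
  unfold dhatMode; positivity

theorem dhatSq_nonneg : 0 ≤ dhatSq f G ρ γ τ x z := by
  rw [dhatSq_eq]
  exact Finset.sum_nonneg fun l _ => dhatMode_nonneg l

theorem norm_modeComponent_le_dhatMode (hρ : 0 < ρ) (hh : 0 < γ * τ) {l : Fin N}
    (hl : 0 < lapEig G l) (hhc : γ * τ * (ρ * lapEig G l) ≤ 1 / 2) :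
    ‖modeComponent G l x‖ ^ 2 ≤ 6 * (γ * τ) / (ρ * lapEig G l) * dhatMode f G ρ γ τ x z l
      ∧ ‖modeComponent G l (devY f G ρ x z)‖ ^ 2 ≤ 18 * dhatMode f G ρ γ τ x z l
      ∧ ‖modeComponent G l (devYt f G ρ x z)‖ ^ 2 ≤ 3 * dhatMode f G ρ γ τ x z l := by
  simp only [EuclideanSpace.norm_sq_eq, dhatMode, Finset.mul_sum (Finset.univ : Finset (Fin n)),
    Real.norm_eq_abs, sq_abs]
  have h := fun c : Fin n => modeMatrix_inv_bounds hρ hl hh hhc (modeComponent G l x c)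
    (modeComponent G l (devY f G ρ x z) c) (modeComponent G l (devYt f G ρ x z) c)
  exact ⟨Finset.sum_le_sum fun c _ => (h c).1, Finset.sum_le_sum fun c _ => (h c).2.1,
    Finset.sum_le_sum fun c _ => (h c).2.2⟩

/-- The initial energy and the initial residual are controlled by `dhatSq`. -/
theorem energy_add_residual_le (hρ : 0 < ρ) (hlam : 0 < lam) (hh : 0 < γ * τ)
    (hd : G.maxDegree ≤ d) (hgap : ∀ l, lapEig G l ≠ 0 → lam ≤ lapEig G l)
    (hs : 4 * (γ * τ) * (ρ * d) ≤ 1) :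
    energy G ρ (γ * τ) (fun i => gradient (localCost f i)) x (dualVar G z)
        ≤ 14 / (ρ * lam) * (γ * τ * dhatSq f G ρ γ τ x z)
      ∧ perpSq G (auxResidual G ρ x (auxSum G z) (dualVar G z))
        ≤ 21 * dhatSq f G ρ γ τ x z := by
  rw [auxResidual_eq (f := f), energy, dualVar_sub_gradient (ρ := ρ), perpSq, dhatSq_eq,
    Finset.mul_sum, Finset.mul_sum, Finset.mul_sum]
  have hmode : ∀ l ∈ modes G, 0 < lapEig G l ∧ lam ≤ lapEig G l
      ∧ γ * τ * (ρ * lapEig G l) ≤ 1 / 2 := by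
    intro l hl
    have hle := hgap l ((mem_modes G).mp hl)
    have := lapEig_le G hd l
    have : γ * τ * (ρ * lapEig G l) ≤ γ * τ * (ρ * (2 * d)) := by gcongr
    exact ⟨hlam.trans_le hle, hle, by linarith⟩
  refine ⟨Finset.sum_le_sum fun l hl => ?_, Finset.sum_le_sum fun l hl => ?_⟩
  · obtain ⟨hμ, hle, hhc⟩ := hmode l hl
    obtain ⟨b1, b2, b3⟩ := norm_modeComponent_le_dhatMode (x := x) (z := z) (f := f) hρ hh hμ hhc
    have hE := dhatMode_nonneg (f := f) (ρ := ρ) (γ := γ) (τ := τ) (x := x) (z := z) (G := G) l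
    -- From the bounds 18 and 3: (18 + 3)/2 ≤ 11. With half of 6 for the x-component this makes 14.
    have hw : ‖modeComponent G l ((1 / 2 : ℝ) • (devY f G ρ x z - devYt f G ρ x z))‖ ^ 2
        ≤ 11 * dhatMode f G ρ γ τ x z l := by
      rw [modeComponent_smul, modeComponent_sub, norm_smul, mul_pow, Real.norm_eq_abs, sq_abs]
      have := norm_sub_sq_le_two (modeComponent G l (devY f G ρ x z))
        (modeComponent G l (devYt f G ρ x z))
      linarith
    have h1 := mul_le_mul_of_nonneg_left hw (show 0 ≤ γ * τ / (ρ * lapEig G l) by positivity)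
    have h2 : 6 * (γ * τ) / (ρ * lapEig G l) * dhatMode f G ρ γ τ x z l
        = 6 * (γ * τ / (ρ * lapEig G l) * dhatMode f G ρ γ τ x z l) := by ring
    have h3 : γ * τ / (ρ * lapEig G l) * dhatMode f G ρ γ τ x z l
        ≤ γ * τ / (ρ * lam) * dhatMode f G ρ γ τ x z l := by gcongr
    have h4 : 14 / (ρ * lam) * (γ * τ * dhatMode f G ρ γ τ x z l)
        = 14 * (γ * τ / (ρ * lam) * dhatMode f G ρ γ τ x z l) := by ring
    linarith
  · obtain ⟨hμ, hle, hhc⟩ := hmode l hl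
    obtain ⟨b1, b2, b3⟩ := norm_modeComponent_le_dhatMode (x := x) (z := z) (f := f) hρ hh hμ hhc
    have hE := dhatMode_nonneg (f := f) (ρ := ρ) (γ := γ) (τ := τ) (x := x) (z := z) (G := G) l
    rw [modeComponent_add, modeComponent_smul, modeComponent_smul, modeComponent_add,
      modeComponent_lapOp, smul_add]
    refine (norm_add_sq_le_three _ _ _).trans ?_
    simp only [norm_smul, mul_pow, Real.norm_eq_abs, sq_abs]
    set c := ρ * lapEig G l with hc
    have hcpos : 0 < c := by positivity
    have e1 : (ρ / 2) ^ 2 * (lapEig G l ^ 2 * ‖modeComponent G l x‖ ^ 2)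
        = c ^ 2 / 4 * ‖modeComponent G l x‖ ^ 2 := by rw [hc]; ring
    have e2 := mul_le_mul_of_nonneg_left b1 (show 0 ≤ c ^ 2 / 4 by positivity)
    have e3 : c ^ 2 / 4 * (6 * (γ * τ) / c * dhatMode f G ρ γ τ x z l)
        = 3 / 2 * (γ * τ * c * dhatMode f G ρ γ τ x z l) := by field_simp; ring
    have e4 := mul_le_mul_of_nonneg_right hhc hE
    rw [e1]
    linarith

end InitialBound

/-! ### Expectations and summation over the rounds -/

section Expectation

variable {N n : ℕ} {m : Fin N → ℕ} {f : (i : Fin N) → Fin (m i) → Vec n → ℝ}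
  {G : SimpleGraph (Fin N)} [DecidableRel G.Adj] {L ρ γ lam σ : ℝ} {τ d : ℕ}
  {Ω : Type*} {B : ℕ → ℕ → Ω → (i : Fin N) → Finset (Fin (m i))}
  {x₀ : Fin N → Vec n} {z₀ : Fin N → Fin N → Vec n}

/-- The draws made before the local step `t` of round `k`. -/
def past (τ k t : ℕ) : Finset (ℕ × ℕ) :=
  Finset.range k ×ˢ Finset.range τ ∪ {k} ×ˢ Finset.range t

theorem notMem_past (τ k t : ℕ) : (k, t) ∉ past τ k t := by simp [past]

theorem isDeterminedBy_state_phi (k t : ℕ) :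
    IsDeterminedBy (fun kt : ℕ × ℕ => B kt.1 kt.2) (past τ k t) fun ω =>
      (state f G ρ γ τ (fun k t => B k t ω) x₀ z₀ k,
        phi f G ρ γ τ (fun k t => B k t ω) x₀ z₀ k t) := by
  intro ω ω' h
  have h1 : state f G ρ γ τ (fun k t => B k t ω) x₀ z₀ k
      = state f G ρ γ τ (fun k t => B k t ω') x₀ z₀ k :=
    state_congr fun j hj s hs => h (j, s) (by simp [past, hj, hs])
  have h2 : phi f G ρ γ τ (fun k t => B k t ω) x₀ z₀ k t
      = phi f G ρ γ τ (fun k t => B k t ω') x₀ z₀ k t := by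
    simp only [phi, h1]
    exact localIter_congr fun s hs => h (k, s) (by simp [past, hs])
  simp only [h1, h2]

theorem IsDeterminedBy.comp {ι β Ω α α' : Type*} {B : ι → Ω → β} {S : Finset ι} {U : Ω → α}
    (hU : IsDeterminedBy B S U) (v : α → α') : IsDeterminedBy B S fun ω => v (U ω) :=
  fun ω ω' h => congrArg v (hU ω ω' h)

/-- `past τ k 0` consists exactly of the draws of the first `k` complete rounds. For the noise of
round `k` it is used with `k + 1`. -/
theorem isDeterminedBy_of_succ {α : Type*} {k : ℕ}
    {U : (ℕ → ℕ → (i : Fin N) → Finset (Fin (m i))) → α}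
    (hU : ∀ b b', (∀ j < k, ∀ s < τ, b j s = b' j s) → U b = U b') :
    IsDeterminedBy (fun kt : ℕ × ℕ => B kt.1 kt.2) (past τ k 0) fun ω => U fun k t => B k t ω :=
  fun ω ω' h => hU _ _ fun j hj s hs => h (j, s) (by simp [past, hj, hs])

theorem phi_congr {b b' : ℕ → ℕ → (i : Fin N) → Finset (Fin (m i))} {k t : ℕ} (ht : t ≤ τ)
    (h : ∀ j < k + 1, ∀ s < τ, b j s = b' j s) :
    phi f G ρ γ τ b x₀ z₀ k t = phi f G ρ γ τ b' x₀ z₀ k t := by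
  simp only [phi, state_congr (f := f) (G := G) (ρ := ρ) (γ := γ) (x₀ := x₀) (z₀ := z₀)
    fun j (hj : j < k) => h j (hj.trans k.lt_succ_self)]
  exact localIter_congr fun s hs => h k k.lt_succ_self s (hs.trans_le ht)

theorem gradNoise_congr {b b' : ℕ → ℕ → (i : Fin N) → Finset (Fin (m i))} {k t : ℕ} (ht : t < τ)
    (h : ∀ j < k + 1, ∀ s < τ, b j s = b' j s) :
    gradNoise f G ρ γ τ b x₀ z₀ k t = gradNoise f G ρ γ τ b' x₀ z₀ k t := by
  funext i
  simp only [gradNoise, phi_congr (f := f) (G := G) (ρ := ρ) (γ := γ) (x₀ := x₀) (z₀ := z₀)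
    ht.le h, h k k.lt_succ_self t ht]

/-- The Lyapunov function of a state. -/
noncomputable def lyapunov (f : (i : Fin N) → Fin (m i) → Vec n → ℝ) (G : SimpleGraph (Fin N))
    [DecidableRel G.Adj] (L ρ lam h : ℝ) (s : (Fin N → Vec n) × (Fin N → Fin N → Vec n)) : ℝ :=
  N * globalCost f (mean s.1) + energyWeight L (ρ * lam)
    * energy G ρ h (fun i => gradient (localCost f i)) s.1 (dualVar G s.2)

variable [MeasurableSpace Ω] {P : Measure Ω}

theorem metric_eq (hf : IsSmoothProblem f L) (k : ℕ) :
    metric f G ρ γ τ P B x₀ z₀ k = ∫ ω,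
      (‖meanField (fun i => gradient (localCost f i))
          (mean (state f G ρ γ τ (fun k t => B k t ω) x₀ z₀ k).1)‖ ^ 2
        + gradSq τ (fun i => gradient (localCost f i))
          (phi f G ρ γ τ (fun k t => B k t ω) x₀ z₀ k)) ∂P := by
  simp only [metric, gradient_globalCost hf, gradSq, timeAvg]

variable [IsProbabilityMeasure P]

theorem IsBatchSampling.integrable (hB : IsBatchSampling f P B σ) {S : Finset (ℕ × ℕ)}
    {E : Type*} [NormedAddCommGroup E] {U : Ω → E}
    (hU : IsDeterminedBy (fun kt : ℕ × ℕ => B kt.1 kt.2) S U) : Integrable U P := by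
  let _ : MeasurableSpace ((i : Fin N) → Finset (Fin (m i))) := ⊤
  exact hU.integrable fun kt : ℕ × ℕ => hB.measurable kt.1 kt.2

theorem IsBatchSampling.integral_eq (hB : IsBatchSampling f P B σ) {α : Type*} {k t : ℕ}
    {U : Ω → α} (hU : IsDeterminedBy (fun kt : ℕ × ℕ => B kt.1 kt.2) (past τ k t) U)
    (Ψ : α → ((i : Fin N) → Finset (Fin (m i))) → ℝ) :
    ∫ ω, Ψ (U ω) (B k t ω) ∂P = ∫ ω, ∫ ω', Ψ (U ω) (B k t ω') ∂P ∂P := by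
  let _ : MeasurableSpace ((i : Fin N) → Finset (Fin (m i))) := ⊤
  exact integral_eq_integral_integral (B := fun kt : ℕ × ℕ => B kt.1 kt.2)
    (fun kt => hB.measurable kt.1 kt.2) hB.indep (notMem_past τ k t) hU Ψ

theorem integrable_batchGrad (hB : IsBatchSampling f P B σ) (k t : ℕ) (i : Fin N) (y : Vec n) :
    Integrable (fun ω => batchGrad f i (B k t ω i) y - gradient (localCost f i) y) P :=
  hB.integrable (S := {(k, t)}) fun ω ω' h => by
    have : B k t ω = B k t ω' := h (k, t) (by simp)
    simp only [this]

/-- Martingale-difference property: `v` and the local iterate depend on earlier draws only, and for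
fixed values of both the new draw averages to zero by unbiasedness. -/
theorem integral_inner_gradNoise (hB : IsBatchSampling f P B σ) (k t : ℕ) (i : Fin N)
    (v : (Fin N → Vec n) × (Fin N → Fin N → Vec n) → Vec n) :
    ∫ ω, inner ℝ (v (state f G ρ γ τ (fun k t => B k t ω) x₀ z₀ k))
      (gradNoise f G ρ γ τ (fun k t => B k t ω) x₀ z₀ k t i) ∂P = 0 := by
  have h := hB.integral_eq (isDeterminedBy_state_phi (f := f) (G := G) (ρ := ρ) (γ := γ) (τ := τ)
    (x₀ := x₀) (z₀ := z₀) k t) (fun u b => inner ℝ (v u.1)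
      (batchGrad f i (b i) (u.2 i) - gradient (localCost f i) (u.2 i)))
  refine h.trans ?_
  have : ∀ (a : Vec n) (y : Vec n),
      ∫ ω', inner ℝ a (batchGrad f i (B k t ω' i) y - gradient (localCost f i) y) ∂P = 0 := by
    intro a y
    rw [integral_inner (integrable_batchGrad hB k t i y), hB.unbiased, inner_zero_right]
  simp only [this, integral_zero]

theorem integral_norm_gradNoise_sq_le (hB : IsBatchSampling f P B σ) (k t : ℕ) (i : Fin N) :
    ∫ ω, ‖gradNoise f G ρ γ τ (fun k t => B k t ω) x₀ z₀ k t i‖ ^ 2 ∂P ≤ σ ^ 2 := by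
  have hdet := isDeterminedBy_state_phi (B := B) (f := f) (G := G) (ρ := ρ) (γ := γ) (τ := τ)
    (x₀ := x₀) (z₀ := z₀) k t
  have h := hB.integral_eq hdet (fun u b =>
    ‖batchGrad f i (b i) (u.2 i) - gradient (localCost f i) (u.2 i)‖ ^ 2)
  refine h.trans_le ?_
  have hint := hB.integrable (hdet.comp fun u => ∫ ω',
    ‖batchGrad f i (B k t ω' i) (u.2 i) - gradient (localCost f i) (u.2 i)‖ ^ 2 ∂P)
  refine (integral_mono hint (integrable_const (σ ^ 2)) fun ω => hB.variance k t i _).trans ?_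
  simp

theorem IsBatchSampling.integrable_state (hB : IsBatchSampling f P B σ) {E : Type*}
    [NormedAddCommGroup E] (v : (Fin N → Vec n) × (Fin N → Fin N → Vec n) → E) (k : ℕ) :
    Integrable (fun ω => v (state f G ρ γ τ (fun k t => B k t ω) x₀ z₀ k)) P :=
  hB.integrable ((isDeterminedBy_state_phi (τ := τ) k 0).comp fun u => v u.1)

theorem IsBatchSampling.integrable_phi (hB : IsBatchSampling f P B σ) {E : Type*}
    [NormedAddCommGroup E] (v : (Fin N → Vec n) → E) (k t : ℕ) :
    Integrable (fun ω => v (phi f G ρ γ τ (fun k t => B k t ω) x₀ z₀ k t)) P :=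
  hB.integrable ((isDeterminedBy_state_phi (τ := τ) k t).comp fun u => v u.2)

theorem IsBatchSampling.integrable_state_gradNoise (hB : IsBatchSampling f P B σ) {E : Type*}
    [NormedAddCommGroup E]
    (v : (Fin N → Vec n) × (Fin N → Fin N → Vec n) → (Fin N → Vec n) → E) {k t : ℕ}
    (ht : t < τ) :
    Integrable (fun ω => v (state f G ρ γ τ (fun k t => B k t ω) x₀ z₀ k)
      (gradNoise f G ρ γ τ (fun k t => B k t ω) x₀ z₀ k t)) P :=
  hB.integrable (isDeterminedBy_of_succ (k := k + 1) (τ := τ)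
    (U := fun b => v (state f G ρ γ τ b x₀ z₀ k) (gradNoise f G ρ γ τ b x₀ z₀ k t))
    fun b b' h => by
      rw [state_congr fun j (hj : j < k) => h j (hj.trans k.lt_succ_self), gradNoise_congr ht h])

theorem integrable_metric (hB : IsBatchSampling f P B σ) (k : ℕ) :
    Integrable (fun ω => ‖meanField (fun i => gradient (localCost f i))
          (mean (state f G ρ γ τ (fun k t => B k t ω) x₀ z₀ k).1)‖ ^ 2
        + gradSq τ (fun i => gradient (localCost f i))
          (phi f G ρ γ τ (fun k t => B k t ω) x₀ z₀ k)) P := by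
  refine (hB.integrable_state (fun s => ‖meanField (fun i => gradient (localCost f i))
    (mean s.1)‖ ^ 2) k).add ?_
  simp only [gradSq, timeAvg]
  exact (integrable_finsetSum _ fun t _ => hB.integrable_phi
    (fun φ => ‖mean fun i => gradient (localCost f i) (φ i)‖ ^ 2) k t).const_mul _

theorem integral_noiseSq_le (hB : IsBatchSampling f P B σ) (hτ : 1 ≤ τ) (k : ℕ) :
    ∫ ω, noiseSq τ (gradNoise f G ρ γ τ (fun k t => B k t ω) x₀ z₀ k) ∂P ≤ N * σ ^ 2 := by
  have hint : ∀ t ∈ Finset.range τ, ∀ i : Fin N, Integrable (fun ω =>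
      ‖gradNoise f G ρ γ τ (fun k t => B k t ω) x₀ z₀ k t i‖ ^ 2) P := fun t ht i =>
    hB.integrable_state_gradNoise (fun _ ξ => ‖ξ i‖ ^ 2) (Finset.mem_range.mp ht)
  simp only [noiseSq, timeAvg]
  rw [integral_const_mul, integral_finsetSum _ fun t ht => integrable_finsetSum _ fun i _ =>
    hint t ht i]
  have h : ∀ t ∈ Finset.range τ, ∫ ω, ∑ i,
      ‖gradNoise f G ρ γ τ (fun k t => B k t ω) x₀ z₀ k t i‖ ^ 2 ∂P ≤ N * σ ^ 2 := by
    intro t ht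
    rw [integral_finsetSum _ fun i _ => hint t ht i]
    refine (Finset.sum_le_sum fun i _ => integral_norm_gradNoise_sq_le hB k t i).trans_eq ?_
    simp
  refine (mul_le_mul_of_nonneg_left (Finset.sum_le_sum h) (by positivity)).trans_eq ?_
  exact timeAvg_const hτ _

theorem integrable_noiseSq (hB : IsBatchSampling f P B σ) (k : ℕ) :
    Integrable (fun ω => noiseSq τ (gradNoise f G ρ γ τ (fun k t => B k t ω) x₀ z₀ k)) P := by
  simp only [noiseSq, timeAvg]
  exact (integrable_finsetSum _ fun t ht => hB.integrable_state_gradNoise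
    (fun _ ξ => ∑ i, ‖ξ i‖ ^ 2) (Finset.mem_range.mp ht)).const_mul _

theorem integrable_inner_roundNoise (hB : IsBatchSampling f P B σ) (k : ℕ)
    (v : (Fin N → Vec n) × (Fin N → Fin N → Vec n) → Fin N → Vec n) :
    Integrable (fun ω => ∑ i, inner ℝ (v (state f G ρ γ τ (fun k t => B k t ω) x₀ z₀ k) i)
      (roundNoise γ τ (gradNoise f G ρ γ τ (fun k t => B k t ω) x₀ z₀ k) i)) P := by
  simp only [roundNoise, inner_smul_right, inner_sum]
  exact integrable_finsetSum _ fun i _ => (integrable_finsetSum _ fun t ht =>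
    hB.integrable_state_gradNoise (fun s ξ => inner ℝ (v s i) (ξ i))
      (Finset.mem_range.mp ht)).const_mul _

theorem integral_inner_roundNoise (hB : IsBatchSampling f P B σ) (k : ℕ)
    (v : (Fin N → Vec n) × (Fin N → Fin N → Vec n) → Fin N → Vec n) :
    ∫ ω, ∑ i, inner ℝ (v (state f G ρ γ τ (fun k t => B k t ω) x₀ z₀ k) i)
      (roundNoise γ τ (gradNoise f G ρ γ τ (fun k t => B k t ω) x₀ z₀ k) i) ∂P = 0 := by
  have hint : ∀ i : Fin N, ∀ t ∈ Finset.range τ, Integrable (fun ω =>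
      inner ℝ (v (state f G ρ γ τ (fun k t => B k t ω) x₀ z₀ k) i)
        (gradNoise f G ρ γ τ (fun k t => B k t ω) x₀ z₀ k t i)) P := fun i t ht =>
    hB.integrable_state_gradNoise (fun s ξ => inner ℝ (v s i) (ξ i)) (Finset.mem_range.mp ht)
  simp only [roundNoise, inner_smul_right, inner_sum]
  rw [integral_finsetSum _ fun i _ => (integrable_finsetSum _ (hint i)).const_mul _]
  refine Finset.sum_eq_zero fun i _ => ?_
  rw [integral_const_mul, integral_finsetSum _ (hint i), Finset.sum_eq_zero, mul_zero]
  exact fun t _ => integral_inner_gradNoise hB k t i fun s => v s i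

theorem integral_le_of_pathwise {V' V p q r : Ω → ℝ} {c : ℝ} (hV' : Integrable V' P)
    (hV : Integrable V P) (hp : Integrable p P) (hq : Integrable q P) (hr : Integrable r P)
    (h : ∀ ω, V' ω ≤ V ω - p ω - q ω + r ω + c) :
    ∫ ω, V' ω ∂P ≤ ∫ ω, V ω ∂P - ∫ ω, p ω ∂P - ∫ ω, q ω ∂P + ∫ ω, r ω ∂P + c := by
  have i1 := hV.sub hp
  have i2 := i1.sub hq
  have i3 := i2.add hr
  have h1 := integral_mono hV' (i3.add (integrable_const c)) h
  rw [integral_add' i3 (integrable_const c), integral_add' i2 hr, integral_sub' i1 hq,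
    integral_sub' hV hp] at h1
  simpa using h1

/-- Expected decrease of the Lyapunov function in one round. -/
theorem integral_lyapunov_le (hG : G.Connected) (hL : 0 < L)
    (hρ : 0 < ρ) (hlam : 0 < lam) (hγ : 0 < γ) (hτ : 1 ≤ τ) (hd : G.maxDegree ≤ d)
    (hgap : ∀ l, lapEig G l ≠ 0 → lam ≤ lapEig G l)
    (hs : IsSmallStep L (ρ * lam) (ρ * d) (γ * τ)) (hf : IsSmoothProblem f L)
    (hc : ∀ i, ConvexOn ℝ Set.univ (localCost f i)) (hB : IsBatchSampling f P B σ)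
    (h₀ : ∑ i, ∑ j ∈ G.neighborFinset i, z₀ i j = ρ • ∑ i, (G.degree i : ℝ) • x₀ i) (k : ℕ) :
    ∫ ω, lyapunov f G L ρ lam (γ * τ) (state f G ρ γ τ (fun k t => B k t ω) x₀ z₀ (k + 1)) ∂P
      + (γ * τ) / 8 * (N * metric f G ρ γ τ P B x₀ z₀ k)
      ≤ ∫ ω, lyapunov f G L ρ lam (γ * τ) (state f G ρ γ τ (fun k t => B k t ω) x₀ z₀ k) ∂P
      + noiseWeight L (ρ * lam) * ((γ * τ) ^ 2 * (N * σ ^ 2))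
      + 16 * energyWeight L (ρ * lam) / (ρ * lam) * ((γ * τ) * if k = 0 then
          perpSq G (auxResidual G ρ x₀ (auxSum G z₀) (dualVar G z₀)) else 0) := by
  have hN : 0 < N := Fin.pos_iff_nonempty.mpr hG.nonempty
  have hA : 0 ≤ energyWeight L (ρ * lam) := by unfold energyWeight; positivity
  have hW : 0 ≤ noiseWeight L (ρ * lam) := by unfold noiseWeight; positivity
  set R : ℝ := if k = 0 then perpSq G (auxResidual G ρ x₀ (auxSum G z₀) (dualVar G z₀)) else 0
    with hR
  -- The residual is not random: it is fixed by the initial data for `k = 0` and vanishes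
  -- afterwards.
  have hres : ∀ b, perpSq G (auxResidual G ρ (state f G ρ γ τ b x₀ z₀ k).1
      (auxSum G (state f G ρ γ τ b x₀ z₀ k).2) (dualVar G (state f G ρ γ τ b x₀ z₀ k).2)) = R := by
    intro b
    cases k with
    | zero => rfl
    | succ k =>
      simp only [state, auxResidual_auxUpdate, hR]
      simp [perpSq, modeComponent]
  set v : (Fin N → Vec n) × (Fin N → Fin N → Vec n) → Fin N → Vec n := fun s i =>
    meanField (fun i => gradient (localCost f i)) (mean s.1)
      + energyWeight L (ρ * lam) • (s.1 i - mean s.1) with hv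
  have hpath : ∀ ω, lyapunov f G L ρ lam (γ * τ)
        (state f G ρ γ τ (fun k t => B k t ω) x₀ z₀ (k + 1))
      ≤ lyapunov f G L ρ lam (γ * τ) (state f G ρ γ τ (fun k t => B k t ω) x₀ z₀ k)
        - (γ * τ) / 8 * (N * (‖meanField (fun i => gradient (localCost f i))
          (mean (state f G ρ γ τ (fun k t => B k t ω) x₀ z₀ k).1)‖ ^ 2
        + gradSq τ (fun i => gradient (localCost f i))
          (phi f G ρ γ τ (fun k t => B k t ω) x₀ z₀ k)))
        - ∑ i, inner ℝ (v (state f G ρ γ τ (fun k t => B k t ω) x₀ z₀ k) i)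
          (roundNoise γ τ (gradNoise f G ρ γ τ (fun k t => B k t ω) x₀ z₀ k) i)
        + noiseWeight L (ρ * lam) * ((γ * τ) ^ 2
          * noiseSq τ (gradNoise f G ρ γ τ (fun k t => B k t ω) x₀ z₀ k))
        + 16 * energyWeight L (ρ * lam) / (ρ * lam) * ((γ * τ) * R) := by
    intro ω
    have h := (isRound_phi (f := f) (γ := γ) (τ := τ) (b := fun k t => B k t ω) h₀ k).lyapunov_le
      hG hL hρ hlam hγ hτ hd hgap (isMonoLipschitz_gradient hf hc) (globalCost_le hN hf hc) hs
      (dualVar G (state f G ρ γ τ (fun k t => B k t ω) x₀ z₀ k).2)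
      (dualVar G (state f G ρ γ τ (fun k t => B k t ω) x₀ z₀ (k + 1)).2)
      (dualVar_auxUpdate _ _)
    rw [hres] at h
    exact h
  have i1 := hB.integrable_state (G := G) (ρ := ρ) (γ := γ) (τ := τ) (x₀ := x₀) (z₀ := z₀)
    (lyapunov f G L ρ lam (γ * τ)) k
  have i2 := hB.integrable_state (G := G) (ρ := ρ) (γ := γ) (τ := τ) (x₀ := x₀) (z₀ := z₀)
    (lyapunov f G L ρ lam (γ * τ)) (k + 1)
  have i3 := ((integrable_metric hB (G := G) (ρ := ρ) (γ := γ) (τ := τ) (x₀ := x₀) (z₀ := z₀)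
    k).const_mul (N : ℝ)).const_mul ((γ * τ) / 8)
  have i4 := integrable_inner_roundNoise hB (G := G) (ρ := ρ) (γ := γ) (τ := τ) (x₀ := x₀)
    (z₀ := z₀) k v
  have i5 := ((integrable_noiseSq hB (G := G) (ρ := ρ) (γ := γ) (τ := τ) (x₀ := x₀) (z₀ := z₀)
    k).const_mul ((γ * τ) ^ 2)).const_mul (noiseWeight L (ρ * lam))
  have h := integral_le_of_pathwise i2 i1 i3 i4 i5 hpath
  rw [integral_inner_roundNoise hB, integral_const_mul, integral_const_mul, integral_const_mul,
    integral_const_mul, ← metric_eq hf] at h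
  have h5 := mul_le_mul_of_nonneg_left (mul_le_mul_of_nonneg_left
    (integral_noiseSq_le hB hτ (G := G) (ρ := ρ) (γ := γ) (x₀ := x₀) (z₀ := z₀) k)
    (sq_nonneg (γ * τ))) hW
  linarith

/-- The sum of the metric over the first `K` rounds. -/
theorem sum_metric_le (hG : G.Connected) (hL : 0 < L)
    (hρ : 0 < ρ) (hlam : 0 < lam) (hγ : 0 < γ) (hτ : 1 ≤ τ) (hd : G.maxDegree ≤ d)
    (hgap : ∀ l, lapEig G l ≠ 0 → lam ≤ lapEig G l)
    (hs : IsSmallStep L (ρ * lam) (ρ * d) (γ * τ)) (hf : IsSmoothProblem f L)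
    (hc : ∀ i, ConvexOn ℝ Set.univ (localCost f i)) (hB : IsBatchSampling f P B σ)
    (h₀ : ∑ i, ∑ j ∈ G.neighborFinset i, z₀ i j = ρ • ∑ i, (G.degree i : ℝ) • x₀ i)
    {xs : Vec n} (hxs : ∀ y, globalCost f xs ≤ globalCost f y) (K : ℕ) :
    (γ * τ) / 8 * (N * ∑ k ∈ Finset.range K, metric f G ρ γ τ P B x₀ z₀ k)
      ≤ N * (globalCost f (mean x₀) - globalCost f xs)
      + K * (noiseWeight L (ρ * lam) * ((γ * τ) ^ 2 * (N * σ ^ 2)))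
      + (energyWeight L (ρ * lam) * (14 / (ρ * lam)) + 16 * energyWeight L (ρ * lam) / (ρ * lam)
          * 21) * (γ * τ * dhatSq f G ρ γ τ x₀ z₀) := by
  have hpos := hs.pos
  have hA : 0 ≤ energyWeight L (ρ * lam) := by unfold energyWeight; positivity
  set R := perpSq G (auxResidual G ρ x₀ (auxSum G z₀) (dualVar G z₀)) with hR
  have hR0 : 0 ≤ R := perpSq_nonneg _ _
  set c := 16 * energyWeight L (ρ * lam) / (ρ * lam) with hcdef
  have hc0 : 0 ≤ c := by positivity
  set V : ℕ → ℝ := fun k => ∫ ω, lyapunov f G L ρ lam (γ * τ)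
    (state f G ρ γ τ (fun k t => B k t ω) x₀ z₀ k) ∂P with hV
  -- The residual is paid once, in round 0, hence the case distinction at `K = 0`.
  have htel : V K + (γ * τ) / 8 * (N * ∑ k ∈ Finset.range K, metric f G ρ γ τ P B x₀ z₀ k)
      ≤ V 0 + K * (noiseWeight L (ρ * lam) * ((γ * τ) ^ 2 * (N * σ ^ 2)))
        + c * ((γ * τ) * if K = 0 then 0 else R) := by
    induction K with
    | zero => simp
    | succ K ih =>
      have h := integral_lyapunov_le hG hL hρ hlam hγ hτ hd hgap hs hf hc hB h₀ K
      have e : V (K + 1) + (γ * τ) / 8 * (N * metric f G ρ γ τ P B x₀ z₀ K)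
        ≤ V K + noiseWeight L (ρ * lam) * ((γ * τ) ^ 2 * (N * σ ^ 2))
        + c * ((γ * τ) * if K = 0 then R else 0) := h
      rw [Finset.sum_range_succ]
      push_cast
      rcases Nat.eq_zero_or_pos K with h0 | h0
      · simp only [h0, Nat.zero_add, if_true] at e ih ⊢
        linarith
      · simp only [h0.ne', if_false] at e ih ⊢
        linarith
  -- The energy is nonnegative, so the minimum of F bounds the Lyapunov function from below.
  have hVK : N * globalCost f xs ≤ V K := by
    have hb : ∀ ω, N * globalCost f xs ≤ lyapunov f G L ρ lam (γ * τ)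
        (state f G ρ γ τ (fun k t => B k t ω) x₀ z₀ K) := by
      intro ω
      have h1 := mul_le_mul_of_nonneg_left
        (hxs (mean (state f G ρ γ τ (fun k t => B k t ω) x₀ z₀ K).1)) (Nat.cast_nonneg (α := ℝ) N)
      have h2 : 0 ≤ energy G ρ (γ * τ) (fun i => gradient (localCost f i))
          (state f G ρ γ τ (fun k t => B k t ω) x₀ z₀ K).1
          (dualVar G (state f G ρ γ τ (fun k t => B k t ω) x₀ z₀ K).2) :=
        Finset.sum_nonneg fun l _ => by
          have := lapEig_nonneg G l
          positivity
      have h3 := mul_nonneg hA h2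
      unfold lyapunov
      linarith
    have h := integral_mono (integrable_const _) (hB.integrable_state (G := G) (ρ := ρ) (γ := γ)
      (τ := τ) (x₀ := x₀) (z₀ := z₀) (lyapunov f G L ρ lam (γ * τ)) K) hb
    simpa using h
  have hV0 : V 0 = N * globalCost f (mean x₀) + energyWeight L (ρ * lam)
      * energy G ρ (γ * τ) (fun i => gradient (localCost f i)) x₀ (dualVar G z₀) := by
    simp [hV, state, lyapunov]
  obtain ⟨e1, e2⟩ := energy_add_residual_le (f := f) (x := x₀) (z := z₀) hρ hlam hpos hd hgap
    hs.coupling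
  have e3 := mul_le_mul_of_nonneg_left e1 hA
  have e4 := mul_le_mul_of_nonneg_left (mul_le_mul_of_nonneg_left e2 hpos.le) hc0
  have e5 : c * ((γ * τ) * if K = 0 then 0 else R) ≤ c * ((γ * τ) * R) := by
    split_ifs
    · have : 0 ≤ c * (γ * τ * R) := by positivity
      simpa using this
    · exact le_rfl
  rw [hV0] at htel
  linarith

end Expectation

end LTADMM

/-! ### Final choice of the constants -/

theorem corollary1 (L ρ lam : ℝ) (d : ℕ) (hL : 0 < L) (hρ : 0 < ρ) (hlam : 0 < lam) :
    -- the constant depends only on `L`, `ρ`, the degree bound and the connectivity of the graph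
    ∃ C : ℝ, 0 < C ∧
      ∀ (N : ℕ) (G : SimpleGraph (Fin N)) [DecidableRel G.Adj], G.Connected → G.maxDegree ≤ d →
        (∀ l, LTADMM.lapEig G l ≠ 0 → lam ≤ LTADMM.lapEig G l) →
      ∀ τ : ℕ, 1 ≤ τ →
      -- the step-size bound depends only on these parameters, on the graph and on `τ`
      ∃ γbar : ℝ, 0 < γbar ∧ ∀ γ : ℝ, 0 < γ → γ < γbar →
      ∀ (n : ℕ) (m : Fin N → ℕ) (f : (i : Fin N) → Fin (m i) → LTADMM.Vec n → ℝ),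
        LTADMM.IsSmoothProblem f L →
        (∀ i, ConvexOn ℝ Set.univ (LTADMM.localCost f i)) →
      ∀ (Ω : Type*) [MeasurableSpace Ω] (P : MeasureTheory.Measure Ω)
        [MeasureTheory.IsProbabilityMeasure P]
        (B : ℕ → ℕ → Ω → (i : Fin N) → Finset (Fin (m i))) (σ : ℝ),
        LTADMM.IsBatchSampling f P B σ →
      ∀ (x₀ : Fin N → LTADMM.Vec n) (z₀ : Fin N → Fin N → LTADMM.Vec n),
        ∑ i, ∑ j ∈ G.neighborFinset i, z₀ i j = ρ • ∑ i, (G.degree i : ℝ) • x₀ i →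
      -- the stationary points are exactly the optimal solutions, and for each of them
      -- the averaged metric obeys the bound and is asymptotically of order `γ τ σ²`
      (∀ xs : LTADMM.Vec n,
        gradient (LTADMM.globalCost f) xs = 0 ↔ LTADMM.IsConsensusOptimum f xs) ∧
      ∀ xs : LTADMM.Vec n, LTADMM.IsConsensusOptimum f xs →
        (∀ K : ℕ, 1 ≤ K →
          (1 / (K : ℝ)) * ∑ k ∈ Finset.range K, LTADMM.metric f G ρ γ τ P B x₀ z₀ k ≤
            C * ((LTADMM.globalCost f (LTADMM.mean x₀) - LTADMM.globalCost f xs) / (K * γ * τ))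
            + C * (γ * τ * σ ^ 2)
            + C * (LTADMM.dhatSq f G ρ γ τ x₀ z₀ / (ρ * K * N))) ∧
        ∀ ε : ℝ, 0 < ε → ∀ᶠ K : ℕ in Filter.atTop,
          (1 / (K : ℝ)) * ∑ k ∈ Finset.range K, LTADMM.metric f G ρ γ τ P B x₀ z₀ k ≤
            C * (γ * τ * σ ^ 2) + ε := by
  have hA : 0 < LTADMM.energyWeight L (ρ * lam) := by unfold LTADMM.energyWeight; positivity
  have hW : 0 < LTADMM.noiseWeight L (ρ * lam) := by unfold LTADMM.noiseWeight; positivity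
  set c := LTADMM.energyWeight L (ρ * lam) * (14 / (ρ * lam))
    + 16 * LTADMM.energyWeight L (ρ * lam) / (ρ * lam) * 21 with hc
  have hcpos : 0 < c := by positivity
  -- The factors 8 undo the decrease rate h/8; the factor ρ in the last summand compensates for the
  -- ρ in the denominator of the last term.
  set C := 8 + 8 * LTADMM.noiseWeight L (ρ * lam) + 8 * ρ * c with hC
  have hCpos : 0 < C := by positivity
  have h8ρc : 0 < 8 * ρ * c := by positivity
  refine ⟨C, hCpos, ?_⟩
  intro N G _ hG hd hgap τ hτ
  have hN : 0 < N := Fin.pos_iff_nonempty.mpr hG.nonempty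
  have hN' : (0 : ℝ) < N := by exact_mod_cast hN
  have hτ' : (0 : ℝ) < τ := by exact_mod_cast hτ
  obtain ⟨h₀, hh₀, hsmall⟩ := LTADMM.exists_isSmallStep (L := L) (ℓ := ρ * lam) (κ := ρ * d) hL
    (by positivity) (by positivity)
  -- All smallness conditions concern γτ only.
  refine ⟨h₀ / τ, by positivity, ?_⟩
  intro γ hγ hγlt n m f hf hconv Ω _ P _ B σ hB x₀ z₀ hz
  have hs := hsmall (γ * τ) (by positivity) ((lt_div_iff₀ hτ').mp hγlt)
  refine ⟨fun xs => ?_, fun xs hxs => ?_⟩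
  · rw [LTADMM.isConsensusOptimum_iff hN, LTADMM.gradient_eq_zero_iff_forall_le
      (LTADMM.convexOn_globalCost hconv) (LTADMM.differentiable_globalCost hf)]
  rw [LTADMM.isConsensusOptimum_iff hN] at hxs
  have hgap0 : 0 ≤ LTADMM.globalCost f (LTADMM.mean x₀) - LTADMM.globalCost f xs :=
    sub_nonneg.mpr (hxs _)
  have hdh := LTADMM.dhatSq_nonneg (f := f) (G := G) (ρ := ρ) (γ := γ) (τ := τ) (x := x₀) (z := z₀)
  have hbound : ∀ K : ℕ, 1 ≤ K →
      (1 / (K : ℝ)) * ∑ k ∈ Finset.range K, LTADMM.metric f G ρ γ τ P B x₀ z₀ k ≤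
        C * ((LTADMM.globalCost f (LTADMM.mean x₀) - LTADMM.globalCost f xs) / (K * γ * τ))
        + C * (γ * τ * σ ^ 2)
        + C * (LTADMM.dhatSq f G ρ γ τ x₀ z₀ / (ρ * K * N)) := by
    intro K hK
    have hK' : (0 : ℝ) < K := by exact_mod_cast hK
    have h := LTADMM.sum_metric_le hG hL hρ hlam hγ hτ hd hgap hs hf hconv hB hz hxs K
    rw [← hc] at h
    set T := ∑ k ∈ Finset.range K, LTADMM.metric f G ρ γ τ P B x₀ z₀ k
    set Δ := LTADMM.globalCost f (LTADMM.mean x₀) - LTADMM.globalCost f xs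
    set dh := LTADMM.dhatSq f G ρ γ τ x₀ z₀
    have h2 := mul_le_mul_of_nonneg_left h (show 0 ≤ 8 / (γ * τ * N * K) by positivity)
    have e1 : 8 / (γ * τ * N * K) * (γ * τ / 8 * (N * T)) = 1 / (K : ℝ) * T := by
      field_simp
    have e2 : 8 / (γ * τ * N * K) * (N * Δ + K * (LTADMM.noiseWeight L (ρ * lam)
        * ((γ * τ) ^ 2 * (N * σ ^ 2))) + c * (γ * τ * dh))
        = 8 * (Δ / (K * γ * τ)) + 8 * LTADMM.noiseWeight L (ρ * lam) * (γ * τ * σ ^ 2)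
          + 8 * ρ * c * (dh / (ρ * K * N)) := by
      field_simp
    rw [e1, e2] at h2
    refine h2.trans ?_
    have c1 : 8 ≤ C := by rw [hC]; linarith
    have c2 : 8 * LTADMM.noiseWeight L (ρ * lam) ≤ C := by rw [hC]; linarith
    have c3 : 8 * ρ * c ≤ C := by rw [hC]; linarith
    gcongr
  refine ⟨hbound, fun ε hε => ?_⟩
  -- The first and third terms of the bound are a constant, for fixed γ and τ, divided by K.
  have hlim : Filter.Tendsto (fun K : ℕ =>
      (C * ((LTADMM.globalCost f (LTADMM.mean x₀) - LTADMM.globalCost f xs) / (γ * τ))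
        + C * (LTADMM.dhatSq f G ρ γ τ x₀ z₀ / (ρ * N))) / (K : ℝ)) Filter.atTop (nhds 0) :=
    tendsto_const_div_atTop_nhds_zero_nat _
  filter_upwards [hlim.eventually_lt_const hε, Filter.eventually_ge_atTop 1] with K h1 h2
  have hK' : (0 : ℝ) < K := by exact_mod_cast h2
  refine (hbound K h2).trans ?_
  have e : (C * ((LTADMM.globalCost f (LTADMM.mean x₀) - LTADMM.globalCost f xs) / (γ * τ))
        + C * (LTADMM.dhatSq f G ρ γ τ x₀ z₀ / (ρ * N))) / (K : ℝ)
      = C * ((LTADMM.globalCost f (LTADMM.mean x₀) - LTADMM.globalCost f xs) / (K * γ * τ))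
        + C * (LTADMM.dhatSq f G ρ γ τ x₀ z₀ / (ρ * K * N)) := by
    field_simp
  linarith
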